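/- Let $K$ be a number field, Galois over $\mathbb{Q}$, of degree $n=[K:\mathbb{Q}]$, and let $\gamma_1,\dots,\gamma_n$ be a fixed $\mathbb{Z}$-basis of its ring of integers $\mathcal{O}_K$; write $[\alpha]\in\mathbb{Z}^n$ for the coordinate vector of $\alpha\in\mathcal{O}_K$ in this basis. For $\mathbf a_1,\mathbf b_1,\mathbf a_2,\mathbf b_2\in\mathbb{Z}^n$ such that all entries $b_{i,j}$ of $\mathbf b_1,\mathbf b_2$ are positive, let $\mathscr B$ be the set of models $E_{\alpha,\beta}\colon Y^2=X^3+\alpha X+\beta$ with $\alpha,\beta\in\mathcal{O}_K$, $\mathbf a_1-\mathbf b_1\le[\alpha]\le\mathbf a_1+\mathbf b_1$ and $\mathbf a_2-\mathbf b_2\le[\beta]\le\mathbf a_2+\mathbf b_2$ (entrywise inequalities), and put $$\mathscr V(\mathscr B)=2^{2n}\prod_{j=1}^n b_{1,j}b_{2,j},\qquad \mathscr V_i(\mathscr B)=2^n\prod_{j=1}^n b_{i,j}\ (i=1,2),\qquad \mathscr V_{\min}(\mathscr B)=2\min_{1\le j\le n}\{b_{1,j},b_{2,j}\}.$$ Let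 $\mathfrak p$ be a degree-$1$ prime of $K$ with $\mathfrak p\nmid 6\prod_{j=1}^n\gamma_j$, let $p$ be the rational prime below $\mathfrak p$, and let $E_{a,b}\colon Y^2=X^3+aX+b$ be an elliptic curve over $\mathcal{O}_K/\mathfrak p\cong\mathbb{F}_p$. Let $\#\mathrm{Aut}_p(E_{a,b})$ be the number of automorphisms of $E_{a,b}$ over $\mathbb{F}_p$. Then $$\#\mathrm{Aut}_p(E_{a,b})=\begin{cases}2&\text{if }ab\neq0,\\ \gcd(4,p-1)&\text{if }a\ne0,\ b=0,\\ \gcd(6,p-1)&\text{if }a=0,\ b\neq0.\end{cases}$$ Let $\mathscr B(E_{a,b},\mathfrak p)$ be the set of models in $\mathscr B$ whose reduction modulo $\mathfrak p$ is isomorphic to $E_{a,b}$ over $\mathcal{O}_K/\mathfrak p$. If $K\ne\mathbb{Q}$ or $ab\neq0$, then $$\#\mathscr B(E_{a,b},\mathfrak p)=\frac{p-1}{p^2\,\#\mathrm{Aut}_p(E_{a,b})}\mathscr V(\mathscr B)+O\!\left(\frac{\mathscr V(\mathscr B)}{p\,\mathscr V_{\min}(\mathscr B)}+\bigl(\mathscr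 V_1(\mathscr B)+\mathscr V_2(\mathscr B)\bigr)p^{n-3/2}(\log p)^n+p^{2n-3/2}(\log p)^{2n}\right),$$ where the implied constant depends only on $K$ and the basis $\gamma_1,\dots,\gamma_n$; in particular it is uniform in $\mathfrak p$, $a$, $b$ and $\mathbf a_1,\mathbf b_1,\mathbf a_2,\mathbf b_2$. -/

import Mathlib

open NumberField

noncomputable section

namespace CurveBox

/-- The model `E_{a,b} : Y² = X³ + aX + b` over a commutative ring. -/
def shortModel {R : Type*} [CommRing R] (a b : R) : WeierstrassCurve R :=
  ⟨0, 0, 0, a, b⟩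

/-- Two Weierstrass curves over `R` are isomorphic over `R` if an admissible change of
variables `(X, Y) ↦ (u²X + r, u³Y + u²sX + t)`, with `u` a unit of `R` and `r, s, t ∈ R`,
carries one to the other. -/
def Isomorphic {R : Type*} [CommRing R] (W W' : WeierstrassCurve R) : Prop :=
  ∃ C : WeierstrassCurve.VariableChange R, C • W = W'

/-- The number of automorphisms over `R` of a Weierstrass curve: the admissible changes of
variables over `R` that fix it. -/
def autCount {R : Type*} [CommRing R] (W : WeierstrassCurve R) : ℕ :=
  Nat.card (MulAction.stabilizer (WeierstrassCurve.VariableChange R) W)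

variable {K : Type*} [Field K] [NumberField K]

/-- The box of algebraic integers whose coordinate vector `c` with respect to the integral
basis `γ` satisfies `a - b ≤ c ≤ a + b` entrywise. -/
def intBox (γ : Module.Basis (Fin (Module.finrank ℚ K)) ℤ (𝓞 K))
    (a b : Fin (Module.finrank ℚ K) → ℤ) : Set (𝓞 K) :=
  {α | ∀ j, a j - b j ≤ γ.repr α j ∧ γ.repr α j ≤ a j + b j}

/-- The box of models `E_{α,β}`, with `α` and `β` in the boxes given by `(a₁, b₁)` and
`(a₂, b₂)`. Distinct pairs `(α, β)` are distinct models. -/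
def modelBox (γ : Module.Basis (Fin (Module.finrank ℚ K)) ℤ (𝓞 K))
    (a₁ b₁ a₂ b₂ : Fin (Module.finrank ℚ K) → ℤ) : Set (WeierstrassCurve (𝓞 K)) :=
  {W | ∃ α ∈ intBox γ a₁ b₁, ∃ β ∈ intBox γ a₂ b₂, W = shortModel α β}

/-- The models in the box whose reduction modulo `P` is isomorphic over `𝓞 K ⧸ P` to `E`. -/
def modelsReducingTo (γ : Module.Basis (Fin (Module.finrank ℚ K)) ℤ (𝓞 K))
    (a₁ b₁ a₂ b₂ : Fin (Module.finrank ℚ K) → ℤ) (P : Ideal (𝓞 K))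
    (E : WeierstrassCurve (𝓞 K ⧸ P)) : Set (WeierstrassCurve (𝓞 K)) :=
  {W | W ∈ modelBox γ a₁ b₁ a₂ b₂ ∧ Isomorphic (W.map (Ideal.Quotient.mk P)) E}

/-- `2ⁿ ∏ⱼ bⱼ`; this is `𝒱₁` for `b = b₁` and `𝒱₂` for `b = b₂`. -/
def vol {n : ℕ} (b : Fin n → ℤ) : ℝ :=
  2 ^ n * ∏ j, (b j : ℝ)

/-- `𝒱 = 2²ⁿ ∏ⱼ b₁ⱼ b₂ⱼ`. -/
def volTotal {n : ℕ} (b₁ b₂ : Fin n → ℤ) : ℝ :=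
  2 ^ (2 * n) * ∏ j, ((b₁ j : ℝ) * (b₂ j : ℝ))

/-- `𝒱_min = 2 minⱼ {b₁ⱼ, b₂ⱼ}` (a minimum over the nonempty finite index set when `n ≥ 1`). -/
def volMin {n : ℕ} (b₁ b₂ : Fin n → ℤ) : ℝ :=
  2 * ⨅ j, min (b₁ j : ℝ) (b₂ j : ℝ)

end CurveBox

end

/-! Since `2` and `3` are invertible modulo `P`, isomorphisms between short models are the scalings
`(a, b) ↦ (u⁴a, u⁶b)`. By orbit and stabilizer, `#Aut` times the required count is the sum over `u ∈
𝔽ₚˣ` of the number of pairs `(α, β)` in the boxes that reduce to `(u⁴a, u⁶b)`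
(`autCount_mul_ncard_eq`).

Detecting these congruences by additive characters turns `p²` times that sum into a sum over
frequencies `(h, k)` of two box sums and an orbit sum `∑ᵤ e(-(h u⁴a + k u⁶b)/p)`. The frequency `(0,
0)` gives `(p - 1)` times the number of lattice points, and passing from points to volumes costs
`𝒱/𝒱_min` up to a constant. If `τ` bounds the other orbit sums and `D` the total size of the box
sums at `h ≠ 0`, the rest is at most `τD(|A| + |B|) + τD²` (`abs_orbitBoxCount_sub_le`). One needs
to save `√p` over the trivial `τ ≤ p` and `D ≪ (p log p)ⁿ`, and the source of the saving depends on
`n`.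

For `n = 1` it is in `τ`: Weil's bound gives `τ ≪ √p`, and this requires `ab ≠ 0`. For `n ≥ 2` it is
in `D`: the matrix `φ(γᵢγⱼ)` of a nonzero functional has rank at least two, which prevents a nonzero
multiple of `(γⱼ mod P)` from having all its least residues much smaller than `√p`
(`exists_freqBound_le`). At each frequency one factor of the box sum is then `O(√p)`.

Weil's bound (`norm_sum_addChar_eval_le`) is proved by Stepanov's method. The `L`-function attached
to `ψ ∘ f` is a polynomial of degree `deg f - 1`, so the exponential sums over all extensions of
`𝔽ₚ` are, up to sign, power sums of `deg f - 1` complex numbers. An auxiliary function on `yᵖ - y =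
f(x)` bounds these sums over extensions of even degree up to a constant, and that growth rate forces
every one of the numbers to have modulus at most `√p`. -/

section CharacterSums

open Polynomial

/-! ### Weights on the Artin–Schreier coordinate ring -/

section ArtinSchreier

variable {k : Type*} [Field k]

/-- The Artin–Schreier polynomial `Y ^ p - Y - f` over `k[X]`. -/
noncomputable def artinSchreierPoly (p : ℕ) (f : k[X]) : k[X][X] :=
  X ^ p - (X + C f)

theorem degree_X_add_C_lt {p : ℕ} (hp : 1 < p) (f : k[X]) :
    degree (X + C f : k[X][X]) < (p : WithBot ℕ) := by
  rw [degree_X_add_C]; exact_mod_cast hp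

theorem artinSchreierPoly_monic {p : ℕ} (hp : 1 < p) (f : k[X]) :
    (artinSchreierPoly p f).Monic :=
  monic_X_pow_sub (degree_X_add_C_lt hp f)

theorem artinSchreierPoly_degree {p : ℕ} (hp : 1 < p) (f : k[X]) :
    (artinSchreierPoly p f).degree = p := by
  rw [artinSchreierPoly, degree_sub_eq_left_of_degree_lt, degree_X_pow]
  rw [degree_X_pow]
  exact degree_X_add_C_lt hp f

/-- The coordinate ring of the affine Artin–Schreier curve `y ^ p - y = f(x)`. -/
abbrev ASRing (p : ℕ) (f : k[X]) := AdjoinRoot (artinSchreierPoly p f)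

theorem mul_sub_smul_mul_eq {A : Type*} [CommRing A] [Algebra k A] (z z' m m' : A) (c c' : k) :
    z * z' - (c * c') • (m * m') = z * (z' - c' • m') + (c' • m') * (z - c • m) := by
  simp only [Algebra.smul_def, map_mul]; ring

namespace ASRing

variable (p : ℕ) (f : k[X])

/-- The monomial `x ^ i * y ^ j`. -/
noncomputable def mon (i j : ℕ) : ASRing p f :=
  AdjoinRoot.of _ (X ^ i) * AdjoinRoot.root _ ^ j

theorem mon_mul (i j i' j' : ℕ) :
    mon p f i j * mon p f i' j' = mon p f (i + i') (j + j') := by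
  simp only [mon, pow_add, map_mul]; ring

theorem root_pow : (AdjoinRoot.root (artinSchreierPoly p f)) ^ p
    = AdjoinRoot.root _ + AdjoinRoot.of _ f := by
  have h : eval₂ (AdjoinRoot.of (artinSchreierPoly p f)) (AdjoinRoot.root _)
      (X ^ p - (X + C f)) = 0 := AdjoinRoot.eval₂_root (artinSchreierPoly p f)
  rw [eval₂_sub, eval₂_add, eval₂_X_pow, eval₂_X, eval₂_C] at h
  exact sub_eq_zero.mp h

/-- The span of the monomials of weight less than `w`, where `x` has weight `p` and `y`
has weight `deg f`. -/
noncomputable def filt (w : ℕ) : Submodule k (ASRing p f) :=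
  Submodule.span k {z | ∃ i j, p * i + f.natDegree * j < w ∧ z = mon p f i j}

theorem mon_mem_filt {i j w : ℕ} (h : p * i + f.natDegree * j < w) :
    mon p f i j ∈ filt p f w :=
  Submodule.subset_span ⟨i, j, h, rfl⟩

theorem filt_mono {w w' : ℕ} (h : w ≤ w') : filt p f w ≤ filt p f w' := by
  apply Submodule.span_mono
  rintro z ⟨i, j, hij, rfl⟩
  exact ⟨i, j, hij.trans_le h, rfl⟩

variable {p f}

/-- The filtration bounds weights strictly, so `w + 1` on one factor means weight at most `w`, and
no unit is lost in the product. -/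
theorem mul_mem_filt {u v : ASRing p f} {w w' : ℕ} (hu : u ∈ filt p f (w + 1))
    (hv : v ∈ filt p f w') : u * v ∈ filt p f (w + w') := by
  have h := Submodule.mul_mem_mul hu hv
  rw [filt, filt, Submodule.span_mul_span] at h
  refine Submodule.span_le.mpr ?_ h
  rintro _ ⟨_, ⟨i, j, hij, rfl⟩, _, ⟨i', j', hij', rfl⟩, rfl⟩
  change mon p f i j * mon p f i' j' ∈ _
  rw [mon_mul]
  apply mon_mem_filt
  rw [mul_add, mul_add]; omega

/-- `z` is a nonzero multiple of a monomial of weight `w` up to terms of smaller weight. -/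
def HasLead (z : ASRing p f) (w : ℕ) : Prop :=
  ∃ c : k, c ≠ 0 ∧ ∃ i j, p * i + f.natDegree * j = w ∧ z - c • mon p f i j ∈ filt p f w

theorem HasLead.mem_filt {z : ASRing p f} {w : ℕ} (h : HasLead z w) :
    z ∈ filt p f (w + 1) := by
  obtain ⟨c, -, i, j, hij, hz⟩ := h
  have := Submodule.add_mem _ (filt_mono p f (Nat.le_succ w) hz)
    (Submodule.smul_mem _ c (mon_mem_filt p f (i := i) (j := j) (w := w + 1) (by omega)))
  simpa using this

theorem hasLead_smul_mon {c : k} (hc : c ≠ 0) (i j : ℕ) :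
    HasLead (c • mon p f i j) (p * i + f.natDegree * j) :=
  ⟨c, hc, i, j, rfl, by simp⟩

theorem hasLead_mon (i j : ℕ) :
    HasLead (mon p f i j) (p * i + f.natDegree * j) := by
  simpa using hasLead_smul_mon (p := p) (f := f) (one_ne_zero (α := k)) i j

theorem HasLead.mul {z z' : ASRing p f} {w w' : ℕ} (h : HasLead z w) (h' : HasLead z' w') :
    HasLead (z * z') (w + w') := by
  have hz := h.mem_filt
  obtain ⟨c, hc, i, j, hij, h1⟩ := h
  obtain ⟨c', hc', i', j', hij', h1'⟩ := h'
  refine ⟨c * c', mul_ne_zero hc hc', i + i', j + j', by rw [← hij, ← hij']; ring, ?_⟩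
  have e : z * z' - (c * c') • mon p f (i + i') (j + j')
      = z * (z' - c' • mon p f i' j') + (c' • mon p f i' j') * (z - c • mon p f i j) := by
    rw [← mon_mul]
    exact mul_sub_smul_mul_eq _ _ _ _ _ _
  rw [e]
  refine Submodule.add_mem _ (mul_mem_filt hz h1') ?_
  rw [add_comm w]
  exact mul_mem_filt (Submodule.smul_mem _ _ (mon_mem_filt p f (by omega))) h1

theorem HasLead.pow {z : ASRing p f} {w : ℕ} (h : HasLead z w) (n : ℕ) :
    HasLead (z ^ n) (n * w) := by
  induction n with
  | zero => simpa [mon] using hasLead_mon (p := p) (f := f) 0 0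
  | succ n ih => rw [pow_succ, Nat.succ_mul]; exact ih.mul h

theorem HasLead.add {z z' : ASRing p f} {w : ℕ} (h : HasLead z w) (h' : z' ∈ filt p f w) :
    HasLead (z + z') w := by
  obtain ⟨c, hc, i, j, hij, h1⟩ := h
  refine ⟨c, hc, i, j, hij, ?_⟩
  rw [add_sub_right_comm]
  exact Submodule.add_mem _ h1 h'

/-- When the weights are distinct, nothing can cancel the term of largest weight. -/
theorem hasLead_sum {ι : Type*} {s : Finset ι} (hs : s.Nonempty)
    {z : ι → ASRing p f} {w : ι → ℕ} (hw : Set.InjOn w s)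
    (h : ∀ i ∈ s, HasLead (z i) (w i)) : ∃ i ∈ s, HasLead (∑ i ∈ s, z i) (w i) := by
  classical
  obtain ⟨i, hi, him⟩ := s.exists_max_image w hs
  refine ⟨i, hi, ?_⟩
  rw [← Finset.add_sum_erase s z hi]
  refine (h i hi).add (Submodule.sum_mem _ fun j hj => ?_)
  have hj' := Finset.mem_of_mem_erase hj
  refine filt_mono p f ?_ (h j hj').mem_filt
  have := him j hj'
  have hne : w j ≠ w i := fun e => Finset.ne_of_mem_erase hj (hw hj' hi e)
  omega

/-- The coordinate polynomials of an element in the basis `1, y, …, y ^ (p - 1)`. -/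
noncomputable def coord (hp : 1 < p) : ASRing p f →ₗ[k[X]] k[X][X] :=
  AdjoinRoot.modByMonicHom (artinSchreierPoly_monic hp f)

theorem coord_injective (hp : 1 < p) : Function.Injective (coord (f := f) hp) :=
  (AdjoinRoot.mk_leftInverse (artinSchreierPoly_monic hp f)).injective

theorem mk_coord (hp : 1 < p) (z : ASRing p f) :
    AdjoinRoot.mk _ (coord hp z) = z :=
  AdjoinRoot.mk_leftInverse (artinSchreierPoly_monic hp f) z

theorem degree_coord_lt (hp : 1 < p) (z : ASRing p f) :
    (coord hp z).degree < (p : WithBot ℕ) := by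
  obtain ⟨g, rfl⟩ := AdjoinRoot.mk_surjective z
  rw [coord, AdjoinRoot.modByMonicHom_mk, ← artinSchreierPoly_degree hp f]
  exact degree_modByMonic_lt _ (artinSchreierPoly_monic hp f)

theorem coord_mon (hp : 1 < p) (i : ℕ) {j : ℕ} (hj : j < p) :
    coord hp (mon p f i j) = C (X ^ i) * X ^ j := by
  have : mon p f i j = AdjoinRoot.mk _ (C (X ^ i) * X ^ j) := by
    simp [mon]
  rw [this, coord, AdjoinRoot.modByMonicHom_mk,
    modByMonic_eq_self_iff (artinSchreierPoly_monic hp f), artinSchreierPoly_degree hp]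
  refine (degree_C_mul_X_pow_le _ _).trans_lt ?_
  exact_mod_cast hj

/-- This is `yᵖ = y + f(x)`. Both `yᵖ` and `x ^ deg f` have weight `p * deg f`, so the rewriting
never raises the weight. -/
theorem mon_reduce (i j : ℕ) :
    mon p f i (j + p) = mon p f i (j + 1)
      + ∑ l ∈ Finset.range (f.natDegree + 1), f.coeff l • mon p f (i + l) j := by
  have hf : AdjoinRoot.of (artinSchreierPoly p f) f
      = ∑ l ∈ Finset.range (f.natDegree + 1),
        f.coeff l • AdjoinRoot.of (artinSchreierPoly p f) (X ^ l) := by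
    refine (congrArg (AdjoinRoot.of (artinSchreierPoly p f))
      f.as_sum_range_C_mul_X_pow).trans ?_
    rw [map_sum]
    refine Finset.sum_congr rfl fun l _ => ?_
    rw [AdjoinRoot.smul_of, smul_eq_C_mul]
  rw [mon, pow_add, root_pow, mul_add, mul_add, hf, Finset.mul_sum, Finset.mul_sum, mon, pow_succ]
  congr 1
  refine Finset.sum_congr rfl fun l _ => ?_
  rw [mon, pow_add, map_mul, mul_smul_comm, mul_smul_comm]
  congr 1; ring

theorem coord_smul (hp : 1 < p) (c : k) (z : ASRing p f) :
    coord hp (c • z) = c • coord hp z := by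
  rw [← algebraMap_smul k[X] c z, map_smul, algebraMap_smul]

/-- Coefficients of weight at least `w` vanish on `filt w`. -/
theorem coeff_coord_eq_zero (hp : 1 < p) {w : ℕ} {z : ASRing p f}
    (hz : z ∈ filt p f w) {i j : ℕ} (hij : w ≤ p * i + f.natDegree * j) :
    ((coord hp z).coeff j).coeff i = 0 := by
  -- For `j' < p` the monomial is its own coordinate vector; larger exponents of `y` are lowered by
  -- `mon_reduce` without raising the weight.
  have key : ∀ j' i' : ℕ, p * i' + f.natDegree * j' < w →
      ((coord hp (mon p f i' j')).coeff j).coeff i = 0 := by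
    intro j'
    induction j' using Nat.strong_induction_on with
    | _ j' ih =>
      intro i' h'
      rcases lt_or_ge j' p with hlt | hge
      · rw [coord_mon hp _ hlt, coeff_C_mul_X_pow]
        split_ifs with h
        · subst h
          rw [coeff_X_pow, if_neg]
          rintro rfl
          omega
        · simp
      · obtain ⟨m, rfl⟩ := Nat.exists_eq_add_of_le' hge
        rw [mon_reduce]
        simp only [map_add, map_sum, coord_smul, coeff_add, finsetSum_coeff, coeff_smul]
        rw [ih (m + 1) (by omega), zero_add]
        · refine Finset.sum_eq_zero fun l hl => ?_
          rw [ih m (by omega), smul_zero]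
          have : l ≤ f.natDegree := by simpa [Nat.lt_succ_iff] using hl
          have := Nat.mul_le_mul_left p this
          rw [mul_add] at h' ⊢
          rw [mul_comm f.natDegree p] at h'
          omega
        · refine lt_of_le_of_lt ?_ h'
          gcongr
  have hz' := hz
  induction hz using Submodule.span_induction with
  | mem z h => obtain ⟨i', j', h', rfl⟩ := h; exact key j' i' h'
  | zero => simp
  | add a b ha hb iha ihb => simp [iha ha, ihb hb]
  | smul c a ha iha => rw [coord_smul, coeff_smul, coeff_smul, iha ha, smul_zero]

/-- In `mon_reduce` only the leading term of `f` keeps the full weight, and its coefficient is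
nonzero. Membership would therefore descend to an exponent of `y` below `p`, where coordinates can
be read off. -/
theorem mon_notMem_filt (hp : 1 < p) (hd : 0 < f.natDegree) (i j : ℕ) :
    mon p f i j ∉ filt p f (p * i + f.natDegree * j) := by
  induction j using Nat.strong_induction_on generalizing i with
  | _ j ih =>
    rcases lt_or_ge j p with hlt | hge
    · intro h
      have := coeff_coord_eq_zero hp h le_rfl
      rw [coord_mon hp _ hlt, coeff_C_mul_X_pow, if_pos rfl, coeff_X_pow, if_pos rfl] at this
      exact one_ne_zero this
    · obtain ⟨m, rfl⟩ := Nat.exists_eq_add_of_le' hge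
      intro h
      rw [mon_reduce, Finset.sum_range_succ] at h
      have e : p * i + f.natDegree * (m + p) = p * (i + f.natDegree) + f.natDegree * m := by ring
      rw [e] at h
      apply ih m (by omega) (i + f.natDegree)
      have h1 : mon p f i (m + 1) ∈ filt p f (p * (i + f.natDegree) + f.natDegree * m) := by
        apply mon_mem_filt
        rw [← e]
        have := Nat.mul_lt_mul_of_pos_left (show m + 1 < m + p by omega) hd
        omega
      have h2 : ∑ l ∈ Finset.range f.natDegree, f.coeff l • mon p f (i + l) m ∈
          filt p f (p * (i + f.natDegree) + f.natDegree * m) := by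
        refine Submodule.sum_mem _ fun l hl => Submodule.smul_mem _ _ (mon_mem_filt p f ?_)
        have := Nat.mul_lt_mul_of_pos_left (Finset.mem_range.mp hl) (show 0 < p by omega)
        rw [mul_add, mul_add]; omega
      have h3 := (Submodule.add_mem_iff_right _ h1).mp h
      have h4 := (Submodule.add_mem_iff_right _ h2).mp h3
      have hl : f.coeff f.natDegree ≠ 0 := by
        rw [coeff_natDegree, leadingCoeff_ne_zero]; rintro rfl; simp at hd
      exact (Submodule.smul_mem_iff _ hl).mp h4

theorem HasLead.ne_zero (hp : 1 < p) (hd : 0 < f.natDegree) {z : ASRing p f} {w : ℕ}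
    (h : HasLead z w) : z ≠ 0 := by
  rintro rfl
  obtain ⟨c, hc, i, j, rfl, h⟩ := h
  rw [zero_sub, Submodule.neg_mem_iff, Submodule.smul_mem_iff _ hc] at h
  exact mon_notMem_filt hp hd i j h

end ASRing

end ArtinSchreier

/-! ### Stepanov's auxiliary function -/

section Stepanov

variable {k : Type*} [Field k]

namespace ASRing

variable {p : ℕ} {f : k[X]}

theorem pow_mem_filt {u : ASRing p f} {w : ℕ} (hu : u ∈ filt p f (w + 1)) (n : ℕ) :
    u ^ n ∈ filt p f (n * w + 1) := by
  induction n with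
  | zero =>
    have := mon_mem_filt p f (i := 0) (j := 0) (w := 1) (by simp)
    simpa [mon] using this
  | succ n ih =>
    rw [pow_succ', Nat.succ_mul, add_comm (n * w) w, add_assoc]
    exact mul_mem_filt hu ih

/-- Modulo `p` the weight is `deg f * j`, which determines `j < p` by coprimality. -/
theorem weight_injective (hcop : p.Coprime f.natDegree) {i i' j j' : ℕ} (hj : j < p)
    (hj' : j' < p) (h : p * i + f.natDegree * j = p * i' + f.natDegree * j') :
    i = i' ∧ j = j' := by
  have hmod : f.natDegree * j ≡ f.natDegree * j' [MOD p] := by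
    have h1 : (p * i + f.natDegree * j) ≡ f.natDegree * j [MOD p] := by
      simp [Nat.ModEq]
    have h2 : (p * i' + f.natDegree * j') ≡ f.natDegree * j' [MOD p] := by
      simp [Nat.ModEq]
    exact h1.symm.trans (h ▸ h2)
  have hjj : j = j' :=
    (Nat.ModEq.cancel_left_of_coprime hcop hmod).eq_of_lt_of_lt hj hj'
  subst hjj
  exact ⟨Nat.eq_of_mul_eq_mul_left (by omega) (Nat.add_right_cancel h), rfl⟩

variable (p f) in
/-- The element with coefficients `c` on the monomials `x ^ i * y ^ j`, `i < A`, `j < p`. -/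
noncomputable def ofBox {A : ℕ} (c : Fin A × Fin p → k) : ASRing p f :=
  ∑ s, c s • mon p f s.1 s.2

theorem ofBox_sub {A : ℕ} (c c' : Fin A × Fin p → k) :
    ofBox p f (c - c') = ofBox p f c - ofBox p f c' := by
  simp [ofBox, sub_smul]

theorem box_weight_lt {A : ℕ} (s : Fin A × Fin p) :
    p * s.1 + f.natDegree * s.2 < p * (A + f.natDegree) := by
  have h1 : p * (s.1 : ℕ) + p ≤ p * A := by
    rw [← Nat.mul_succ]; exact Nat.mul_le_mul_left _ s.1.2
  have h2 : f.natDegree * (s.2 : ℕ) ≤ f.natDegree * p := Nat.mul_le_mul_left _ s.2.2.le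
  have h3 : 0 < p := s.2.pos
  rw [mul_add, mul_comm p f.natDegree]; omega

theorem ofBox_mem_filt {A : ℕ} (c : Fin A × Fin p → k) :
    ofBox p f c ∈ filt p f (p * (A + f.natDegree)) :=
  Submodule.sum_mem _ fun s _ => Submodule.smul_mem _ _ (mon_mem_filt p f (box_weight_lt s))

theorem exists_hasLead_ofBox (hcop : p.Coprime f.natDegree) {A : ℕ} {c : Fin A × Fin p → k}
    (hc : c ≠ 0) : ∃ w < p * (A + f.natDegree), HasLead (ofBox p f c) w := by
  classical
  have hsum : ofBox p f c = ∑ s with c s ≠ 0, c s • mon p f s.1 s.2 := by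
    rw [ofBox, Finset.sum_filter_of_ne]
    intro s _ h
    contrapose! h
    simp [h]
  obtain ⟨s₀, hs₀⟩ := Function.ne_iff.mp hc
  obtain ⟨s, -, hs⟩ := hasLead_sum (p := p) (f := f) (s := Finset.univ.filter fun s => c s ≠ 0)
    ⟨s₀, by simpa using hs₀⟩ (z := fun s => c s • mon p f s.1 s.2)
    (w := fun s => p * s.1 + f.natDegree * s.2)
    (by
      intro s _ s' _ h
      have := weight_injective hcop s.2.2 s'.2.2 h
      exact Prod.ext (Fin.ext this.1) (Fin.ext this.2))
    (fun s hs => hasLead_smul_mon (by simpa using hs) _ _)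
  exact ⟨_, box_weight_lt s, hsum ▸ hs⟩

theorem charP [CharP k p] (hp : 1 < p) (hd : 0 < f.natDegree) : CharP (ASRing p f) p := by
  have : Nontrivial (ASRing p f) := ⟨_, _, (hasLead_mon 0 0).ne_zero hp hd⟩
  exact charP_of_injective_algebraMap (algebraMap k (ASRing p f)).injective p

/-- The coefficients of low degree determine elements of `filt`. -/
theorem eq_of_coeff_coord_eq (hp : 1 < p) {D : ℕ} {z z' : ASRing p f}
    (hz : z ∈ filt p f (p * D)) (hz' : z' ∈ filt p f (p * D))
    (h : ∀ (j : Fin p) (i : Fin D),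
      ((coord hp z).coeff j).coeff i = ((coord hp z').coeff j).coeff i) : z = z' := by
  apply coord_injective hp
  ext j i
  rcases lt_or_ge j p with hj | hj
  · rcases lt_or_ge i D with hi | hi
    · exact h ⟨j, hj⟩ ⟨i, hi⟩
    · have : p * D ≤ p * i + f.natDegree * j :=
        (Nat.mul_le_mul_left p hi).trans (Nat.le_add_right _ _)
      rw [coeff_coord_eq_zero hp hz this, coeff_coord_eq_zero hp hz' this]
  · have hc : ∀ z : ASRing p f, (coord hp z).coeff j = 0 := fun z =>
      coeff_eq_zero_of_degree_lt ((degree_coord_lt hp z).trans_le (by exact_mod_cast hj))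
    rw [hc, hc]

/-- A nonzero relation `∑ aₛ ^ Q * s = 0` with `aₛ` in a box, `s` over monomials of a box. -/
theorem exists_relation [Finite k] [CharP k p] [Fact p.Prime] (hd : 0 < f.natDegree)
    {e A B D : ℕ} (hA : p * (A + f.natDegree) ≤ p ^ e)
    (hD : p ^ e * (p ^ e - 1) + p * (B + f.natDegree) ≤ p * D) (hcard : D < A * (p * B)) :
    ∃ c : Fin B × Fin p → Fin A × Fin p → k, c ≠ 0 ∧
      ∑ s, ofBox p f (c s) ^ p ^ e * mon p f s.1 s.2 = 0 := by
  have hp : 1 < p := (Fact.out : p.Prime).one_lt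
  have := charP (k := k) (f := f) hp hd
  have := Fintype.ofFinite k
  set Φ : (Fin B × Fin p → Fin A × Fin p → k) → ASRing p f :=
    fun c => ∑ s, ofBox p f (c s) ^ p ^ e * mon p f s.1 s.2 with hΦ
  have hQ : 0 < p ^ e := by positivity
  have hmem : ∀ c, Φ c ∈ filt p f (p * D) := by
    intro c
    refine Submodule.sum_mem _ fun s _ => ?_
    have h1 : ofBox p f (c s) ∈ filt p f (p ^ e - 1 + 1) :=
      filt_mono p f (by omega) (ofBox_mem_filt (c s))
    exact filt_mono p f hD
      (mul_mem_filt (pow_mem_filt h1 _) (mon_mem_filt p f (box_weight_lt s)))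
  -- Pigeonhole: there are more coefficient families than possible coordinate arrays. As `Q`-th
  -- powers are additive in characteristic `p`, two families with the same image differ by a
  -- relation.
  have hlt : Fintype.card (Fin p → Fin D → k)
      < Fintype.card (Fin B × Fin p → Fin A × Fin p → k) := by
    simp only [Fintype.card_fun, Fintype.card_prod, Fintype.card_fin, ← pow_mul]
    refine Nat.pow_lt_pow_right (Fintype.one_lt_card (α := k)) ?_
    calc D * p < A * (p * B) * p := by gcongr
      _ = _ := by ring
  obtain ⟨c, c', hne, heq⟩ := Fintype.exists_ne_map_eq_of_card_lt
    (fun c (j : Fin p) (i : Fin D) => ((coord hp (Φ c)).coeff j).coeff i) hlt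
  have hcc : Φ c = Φ c' :=
    eq_of_coeff_coord_eq hp (hmem c) (hmem c') fun j i => congrFun (congrFun heq j) i
  refine ⟨c - c', sub_ne_zero.mpr hne, ?_⟩
  simp only [Pi.sub_apply, ofBox_sub, sub_pow_char_pow, sub_mul, Finset.sum_sub_distrib]
  exact sub_eq_zero.mpr hcc

/-- The leading weights are `w + Q * weight(s)` with `w < Q`. Division by `Q` recovers the weight of
`s`, hence `s` itself, so the leading weights are distinct and no cancellation is possible. -/
theorem sum_mul_pow_ne_zero [Fact p.Prime] (hd : 0 < f.natDegree) (hcop : p.Coprime f.natDegree)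
    {A B Q : ℕ} (hA : p * (A + f.natDegree) ≤ Q) {c : Fin B × Fin p → Fin A × Fin p → k}
    (hc : c ≠ 0) : ∑ s, ofBox p f (c s) * mon p f s.1 s.2 ^ Q ≠ 0 := by
  classical
  have hsum : ∑ s, ofBox p f (c s) * mon p f s.1 s.2 ^ Q
      = ∑ s with c s ≠ 0, ofBox p f (c s) * mon p f s.1 s.2 ^ Q := by
    rw [Finset.sum_filter_of_ne]
    intro s _ h
    contrapose! h
    simp [h, ofBox]
  obtain ⟨s₀, hs₀⟩ := Function.ne_iff.mp hc
  have hw : ∀ s, ∃ w, c s ≠ 0 → w < Q ∧ HasLead (ofBox p f (c s)) w := by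
    intro s
    by_cases h : c s = 0
    · exact ⟨0, fun h' => (h' h).elim⟩
    · obtain ⟨w, hw, hl⟩ := exists_hasLead_ofBox hcop h
      exact ⟨w, fun _ => ⟨hw.trans_le hA, hl⟩⟩
  choose w hw using hw
  obtain ⟨s, -, hs⟩ := hasLead_sum (p := p) (f := f) (s := Finset.univ.filter fun s => c s ≠ 0)
    ⟨s₀, by simpa using hs₀⟩ (z := fun s => ofBox p f (c s) * mon p f s.1 s.2 ^ Q)
    (w := fun s => w s + Q * (p * s.1 + f.natDegree * s.2))
    (by
      intro s hs s' hs' h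
      simp only [Finset.coe_filter, Finset.mem_univ, true_and, Set.mem_ofPred_eq] at hs hs'
      have h1 := congrArg (· / Q) h
      have hQ : 0 < Q := (Nat.zero_le _).trans_lt (hw s hs).1
      simp only [Nat.add_mul_div_left _ _ hQ, Nat.div_eq_of_lt (hw s hs).1,
        Nat.div_eq_of_lt (hw s' hs').1, zero_add] at h1
      have := weight_injective hcop s.2.2 s'.2.2 h1
      exact Prod.ext (Fin.ext this.1) (Fin.ext this.2))
    (fun s hs => (hw s (by simpa using hs)).2.mul ((hasLead_mon _ _).pow Q))
  rw [hsum]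
  exact hs.ne_zero (Fact.out : p.Prime).one_lt hd

/-- Evaluation at a point of the Artin–Schreier curve. -/
noncomputable def evalAt (x y : k) (h : y ^ p - y = f.eval x) : ASRing p f →+* k :=
  AdjoinRoot.lift (evalRingHom x) y (by
    simp [artinSchreierPoly, ← h])

theorem evalAt_eq (hp : 1 < p) {x y : k} (h : y ^ p - y = f.eval x) (z : ASRing p f) :
    evalAt x y h z = ((coord hp z).map (evalRingHom x)).eval y := by
  conv_lhs => rw [← mk_coord hp z]
  rw [evalAt, AdjoinRoot.lift_mk, eval₂_eq_eval_map]

/-- If `z` vanishes at all rational points then so do its coordinates. -/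
theorem eval_coeff_coord_eq_zero [CharP k p] [Fact p.Prime] {z : ASRing p f}
    (hz : ∀ x y h, evalAt x y h z = 0) {x y : k} (h : y ^ p - y = f.eval x) (j : ℕ) :
    ((coord (Fact.out : p.Prime).one_lt z).coeff j).eval x = 0 := by
  have hp : 1 < p := (Fact.out : p.Prime).one_lt
  -- The fibre over `x` contains the `p` points `y + n` with `n ∈ 𝔽ₚ`, too many zeros for a nonzero
  -- polynomial of degree less than `p` in `y`.
  have hP : (coord hp z).map (evalRingHom x) = 0 := by
    by_contra hne
    have hinj : Function.Injective fun n : Fin p => y + ((n : ℕ) : k) := by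
      intro n m hnm
      have := CharP.natCast_injOn_Iio k p n.2 m.2 (add_left_cancel hnm)
      exact Fin.ext this
    refine hne (eq_zero_of_degree_lt_of_eval_index_eq_zero (Finset.univ)
      (v := fun n : Fin p => y + ((n : ℕ) : k)) hinj.injOn ?_ ?_)
    · refine (degree_map_le).trans_lt ?_
      simpa using degree_coord_lt hp z
    · intro n _
      have hn : ((n : ℕ) : k) ^ p = (n : ℕ) := map_natCast (frobenius k p) n
      have h' : (y + ((n : ℕ) : k)) ^ p - (y + ((n : ℕ) : k)) = f.eval x := by
        rw [add_pow_char, hn, ← h]; ring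
      rw [← evalAt_eq hp h', hz]
  have := congrArg (fun P => coeff P j) hP
  simpa using this

end ASRing

open ASRing in
/-- **Stepanov's bound** for Artin–Schreier curves over a field with `p ^ (2 * (e + 1))`
elements. -/
theorem card_artinSchreier_le [Finite k] {p : ℕ} [CharP k p] [Fact p.Prime] {e : ℕ}
    (hk : Nat.card k = (p ^ (e + 1)) ^ 2) {f : k[X]} (hd : 0 < f.natDegree)
    (hcop : p.Coprime f.natDegree)
    (he : f.natDegree ^ 2 + 4 * f.natDegree + 2 < 2 * p ^ e) (hde : f.natDegree ≤ p ^ e) :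
    {x : k | ∃ y, y ^ p - y = f.eval x}.ncard
      ≤ p ^ (e + 1) * (p ^ e + 2 * f.natDegree + 2) := by
  have hp : 1 < p := (Fact.out : p.Prime).one_lt
  set d := f.natDegree with hdef
  -- With `Q = p ^ (e + 1)`, this `A` makes `p(A + d) = Q`. For `B = A + 2d + 2` the weight
  -- condition on `D` becomes an equality, and `D < A * (p * B)` amounts to `2d + 2 < p(2A - d²)`,
  -- which follows from `he`.
  obtain ⟨A, hA⟩ : ∃ A, p ^ e = A + d := Nat.exists_eq_add_of_le' hde
  have hQ : p ^ (e + 1) = p * (A + d) := by rw [pow_succ', hA]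
  have hA' : p * (A + d) ≤ p ^ (e + 1) := hQ.ge
  obtain ⟨c, hc, hrel⟩ := exists_relation (k := k) (f := f) hd (e := e + 1) (A := A)
    (B := A + 2 * d + 2) (D := (A + d) * p ^ (e + 1) + 2 * d + 2) hA' (by
      have : 0 < p ^ (e + 1) := by positivity
      zify [this]
      rw [← hdef]
      have hQ' : (p : ℤ) ^ (e + 1) = p * (A + d) := by exact_mod_cast hQ
      rw [hQ']
      apply le_of_eq; ring) (by
      rw [hQ]
      rw [hA] at he
      nlinarith [Nat.mul_le_mul_right (2 * A - (d * d)) hp.le,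
        mul_le_mul hp.le he.le (by omega) (by omega)])
  -- The exponent `Q` is moved from the coefficients to the monomials. At rational points `a ^ Q² =
  -- a`, so `G ^ Q` takes there the values of the vanishing relation, although `G` itself is
  -- nonzero.
  set G := ∑ s, ofBox p f (c s) * mon p f s.1 s.2 ^ p ^ (e + 1) with hG
  have hG0 : G ≠ 0 := sum_mul_pow_ne_zero hd hcop hA' hc
  have := Fintype.ofFinite k
  have hfrob : ∀ a : k, (a ^ p ^ (e + 1)) ^ p ^ (e + 1) = a := by
    intro a
    rw [← pow_mul, ← sq, ← hk, Nat.card_eq_fintype_card]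
    exact FiniteField.pow_card a
  have hvan : ∀ x y h, evalAt x y h G = 0 := by
    intro x y h
    have h0 : (evalAt x y h G) ^ p ^ (e + 1) = 0 := by
      rw [hG, map_sum, sum_pow_char_pow]
      rw [← map_zero (evalAt x y h), ← hrel, map_sum]
      refine Finset.sum_congr rfl fun s _ => ?_
      rw [map_mul, map_mul, mul_pow, map_pow, map_pow, hfrob]
    exact pow_eq_zero_iff (by positivity) |>.mp h0
  have hGmem : G ∈ filt p f (p * (p ^ (e + 1) * (p ^ e + 2 * d + 2))) := by
    refine Submodule.sum_mem _ fun s _ => ?_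
    have hQ0 : 0 < p ^ (e + 1) := by positivity
    have h1 : ofBox p f (c s) ∈ filt p f (p ^ (e + 1) - 1 + 1) :=
      filt_mono p f (by rw [← hdef]; omega) (ofBox_mem_filt (c s))
    set m := p * (A + 2 * d + 2 + d) with hm
    have hm0 : 0 < m := by positivity
    have h2 : mon p f s.1 s.2 ∈ filt p f (m - 1 + 1) :=
      mon_mem_filt p f (by have := box_weight_lt (f := f) s; rw [← hdef] at this ⊢; omega)
    refine filt_mono p f ?_ (mul_mem_filt h1 (pow_mem_filt h2 _))
    have e1 : p ^ (e + 1) - 1 + (p ^ (e + 1) * (m - 1) + 1) = p ^ (e + 1) * m := by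
      zify [hQ0, hm0]; ring
    rw [e1, hm, hA]
    apply le_of_eq; ring
  obtain ⟨j, hj⟩ : ∃ j, (coord hp G).coeff j ≠ 0 := by
    by_contra! h
    exact hG0 (coord_injective hp (by rw [map_zero]; ext1 j; simp [h j]))
  set g := (coord hp G).coeff j with hg
  have hdeg : g.natDegree < p ^ (e + 1) * (p ^ e + 2 * d + 2) := by
    by_contra! hle
    have : g.coeff g.natDegree = 0 := coeff_coord_eq_zero hp hGmem
      ((Nat.mul_le_mul_left p hle).trans (Nat.le_add_right _ _))
    rw [coeff_natDegree, leadingCoeff_eq_zero] at this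
    exact hj this
  classical
  have hsub : {x : k | ∃ y, y ^ p - y = f.eval x} ⊆ g.roots.toFinset := by
    rintro x ⟨y, h⟩
    simp only [Finset.mem_coe, Multiset.mem_toFinset, mem_roots hj, IsRoot]
    exact eval_coeff_coord_eq_zero hvan h j
  calc _ ≤ (g.roots.toFinset : Set k).ncard := Set.ncard_le_ncard hsub (Finset.finite_toSet _)
    _ = g.roots.toFinset.card := Set.ncard_coe_finset _
    _ ≤ g.natDegree := (Multiset.toFinset_card_le _).trans (card_roots' g)
    _ ≤ _ := hdeg.le

end Stepanov

/-! ### From point counts to exponential sums -/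

section TraceSums

variable {p : ℕ} [Fact p.Prime] {L : Type*} [Field L] [Finite L] [Algebra (ZMod p) L]

/-- Additive Hilbert 90 over the prime field. -/
theorem exists_pow_sub_eq_of_trace_eq_zero {z : L} (hz : Algebra.trace (ZMod p) L z = 0) :
    ∃ y : L, y ^ p - y = z := by
  have : CharP L p := charP_of_injective_algebraMap (algebraMap (ZMod p) L).injective p
  let φ : L →+ L := (frobenius L p : L →+ L) - AddMonoidHom.id L
  have hφ : ∀ y, φ y = y ^ p - y := fun y => rfl
  let τ : L →+ ZMod p := (Algebra.trace (ZMod p) L).toAddMonoidHom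
  -- Counting: the kernel of `y ↦ yᵖ - y` has at most `p` elements, so its image is at least as
  -- large as the kernel of the surjective trace, which contains it.
  have hker : Nat.card φ.ker ≤ p := by
    classical
    have hp : 1 < p := (Fact.out : p.Prime).one_lt
    have hne : (X ^ p - X : L[X]) ≠ 0 := FiniteField.X_pow_card_sub_X_ne_zero L hp
    have hsub : (φ.ker : Set L) ⊆ ((X ^ p - X : L[X]).roots.toFinset : Set L) := by
      intro y hy
      have : y ^ p - y = 0 := hy
      simp [mem_roots hne, this]
    calc Nat.card φ.ker = (φ.ker : Set L).ncard := Nat.card_coe_set_eq _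
      _ ≤ ((X ^ p - X : L[X]).roots.toFinset : Set L).ncard :=
          Set.ncard_le_ncard hsub (Finset.finite_toSet _)
      _ = (X ^ p - X : L[X]).roots.toFinset.card := Set.ncard_coe_finset _
      _ ≤ (X ^ p - X : L[X]).natDegree := (Multiset.toFinset_card_le _).trans (card_roots' _)
      _ = p := FiniteField.X_pow_card_sub_X_natDegree_eq L hp
  have hle : φ.range ≤ τ.ker := by
    rintro _ ⟨y, rfl⟩
    change Algebra.trace (ZMod p) L (φ y) = 0
    rw [hφ, map_sub, sub_eq_zero]
    have h := Algebra.trace_eq_of_algEquiv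
      (FiniteField.frobeniusAlgEquivOfAlgebraic (ZMod p) L) y
    simpa using h
  have h1 : Nat.card φ.ker * Nat.card φ.range = Nat.card L := by
    rw [← AddSubgroup.index_ker, AddSubgroup.card_mul_index]
  have h2 : Nat.card τ.ker * p = Nat.card L := by
    rw [← AddSubgroup.card_mul_index τ.ker, AddSubgroup.index_ker]
    congr 1
    have : τ.range = ⊤ := AddMonoidHom.range_eq_top.mpr (Algebra.trace_surjective (ZMod p) L)
    rw [this, AddSubgroup.card_top, Nat.card_zmod]
  have heq : φ.range = τ.ker := by
    refine AddSubgroup.eq_of_le_of_card_ge hle ?_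
    have hp : 0 < p := (Fact.out : p.Prime).pos
    refine Nat.le_of_mul_le_mul_right ?_ hp
    rw [h2, ← h1, mul_comm]
    exact Nat.mul_le_mul_left _ hker
  have : z ∈ φ.range := heq ▸ (show τ z = 0 from hz)
  obtain ⟨y, hy⟩ := this
  exact ⟨y, hy⟩

variable (L) in
/-- The exponential sum of `f` over an extension field of `ZMod p`. -/
noncomputable def traceSum (ψ : AddChar (ZMod p) ℂ) (f : (ZMod p)[X]) : ℂ :=
  ∑ᶠ x : L, ψ (Algebra.trace (ZMod p) L (aeval x f))

variable {f : (ZMod p)[X]}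

theorem card_trace_eq_le (hd : 0 < f.natDegree) (hcop : p.Coprime f.natDegree) {e : ℕ}
    (hr : Module.finrank (ZMod p) L = 2 * (e + 1))
    (he : f.natDegree ^ 2 + 4 * f.natDegree + 2 < 2 * p ^ e) (hde : f.natDegree ≤ p ^ e)
    (c : ZMod p) :
    {x : L | Algebra.trace (ZMod p) L (aeval x f) = c}.ncard
      ≤ p ^ (e + 1) * (p ^ e + 2 * f.natDegree + 2) := by
  have : CharP L p := charP_of_injective_algebraMap (algebraMap (ZMod p) L).injective p
  obtain ⟨z, hz⟩ := Algebra.trace_surjective (ZMod p) L c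
  have hdeg : (f.map (algebraMap (ZMod p) L) - C z).natDegree = f.natDegree := by
    rw [natDegree_sub_C, natDegree_map]
  have hk : Nat.card L = (p ^ (e + 1)) ^ 2 := by
    rw [← FiniteField.pow_finrank_eq_natCard p L, hr]; ring
  have := card_artinSchreier_le (f := f.map (algebraMap (ZMod p) L) - C z) hk
    (by rwa [hdeg]) (by rwa [hdeg]) (by rwa [hdeg]) (by rwa [hdeg])
  rw [hdeg] at this
  refine (Set.ncard_le_ncard ?_ (Set.toFinite _)).trans this
  intro x hx
  apply exists_pow_sub_eq_of_trace_eq_zero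
  simp only [Set.mem_ofPred_eq] at hx
  rw [eval_sub, eval_C, eval_map_algebraMap, map_sub, hx, hz, sub_self]

theorem norm_traceSum_le (ψ : AddChar (ZMod p) ℂ) : ‖traceSum L ψ f‖ ≤ Nat.card L := by
  have := Fintype.ofFinite L
  rw [traceSum, finsum_eq_sum_of_fintype]
  refine (norm_sum_le _ _).trans ?_
  simp [AddChar.norm_apply]

/-- Upper bounds suffice: the total is `p * M`, so one class can fall below `M` only by as much as
the other `p - 1` exceed it. The constant `M` is then removed by `∑ ψ = 0`. -/
theorem norm_sum_addChar_mul_le {ψ : AddChar (ZMod p) ℂ} (hψ : ψ ≠ 1) {N : ZMod p → ℝ}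
    {M B : ℝ} (hsum : ∑ c, N c = p * M) (hN : ∀ c, N c ≤ M + B) :
    ‖∑ c, ψ c * N c‖ ≤ p ^ 2 * B := by
  have hB : 0 ≤ B := by
    have h := Finset.sum_le_sum fun c (_ : c ∈ Finset.univ) => hN c
    rw [hsum] at h
    simp only [Finset.sum_const, Finset.card_univ, ZMod.card, nsmul_eq_mul] at h
    have hp : (0 : ℝ) < p := by exact_mod_cast (Fact.out : p.Prime).pos
    nlinarith
  have habs : ∀ c, |N c - M| ≤ p * B := by
    intro c
    have hp : (1 : ℝ) ≤ p := by exact_mod_cast (Fact.out : p.Prime).one_le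
    rw [abs_le]
    constructor
    · have h := Finset.sum_le_sum fun c' (_ : c' ∈ Finset.univ.erase c) => hN c'
      rw [Finset.sum_const, Finset.card_erase_of_mem (Finset.mem_univ c), Finset.card_univ,
        ZMod.card, nsmul_eq_mul, Nat.cast_sub (Fact.out : p.Prime).one_le] at h
      have h2 := Finset.add_sum_erase Finset.univ N (Finset.mem_univ c)
      rw [hsum] at h2
      push_cast at h
      nlinarith
    · nlinarith [hN c]
  have h0 : ∑ c, ψ c = 0 := AddChar.sum_eq_zero_of_ne_one hψ
  have heq : ∑ c, ψ c * N c = ∑ c, ψ c * ((N c - M : ℝ) : ℂ) := by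
    simp only [Complex.ofReal_sub, mul_sub, Finset.sum_sub_distrib, ← Finset.sum_mul, h0]
    simp
  rw [heq]
  calc _ ≤ ∑ c : ZMod p, ‖ψ c * ((N c - M : ℝ) : ℂ)‖ := norm_sum_le _ _
    _ ≤ ∑ _c : ZMod p, p * B := by
      refine Finset.sum_le_sum fun c _ => ?_
      rw [norm_mul, AddChar.norm_apply, one_mul, Complex.norm_real]
      exact habs c
    _ = p ^ 2 * B := by
      simp only [Finset.sum_const, Finset.card_univ, ZMod.card, nsmul_eq_mul]; ring

theorem norm_traceSum_le_of_finrank {ψ : AddChar (ZMod p) ℂ} (hψ : ψ ≠ 1)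
    (hd : 0 < f.natDegree) (hcop : p.Coprime f.natDegree) {e : ℕ}
    (hr : Module.finrank (ZMod p) L = 2 * (e + 1))
    (he : f.natDegree ^ 2 + 4 * f.natDegree + 2 < 2 * p ^ e) (hde : f.natDegree ≤ p ^ e) :
    ‖traceSum L ψ f‖ ≤ p ^ 2 * ((2 * f.natDegree + 2) * (p : ℝ) ^ (e + 1)) := by
  classical
  have := Fintype.ofFinite L
  set T : L → ZMod p := fun x => Algebra.trace (ZMod p) L (aeval x f) with hT
  have hfib : traceSum L ψ f = ∑ c, ψ c * (((Finset.univ.filter fun x => T x = c).card : ℝ) : ℂ) := by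
    rw [traceSum, finsum_eq_sum_of_fintype, ← Finset.sum_fiberwise_of_maps_to
      (g := T) (t := Finset.univ) (fun _ _ => Finset.mem_univ _)]
    refine Finset.sum_congr rfl fun c _ => ?_
    rw [Finset.sum_congr rfl (g := fun _ => ψ c)
      (fun x hx => by rw [← (Finset.mem_filter.mp hx).2])]
    simp [mul_comm]
  rw [hfib]
  refine norm_sum_addChar_mul_le hψ (M := p ^ (e + 1) * p ^ e) ?_ fun c => ?_
  · rw [← Nat.cast_sum, ← Finset.card_eq_sum_card_fiberwise (fun _ _ => Finset.mem_univ _),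
      Finset.card_univ, ← Nat.card_eq_fintype_card, ← FiniteField.pow_finrank_eq_natCard p L, hr]
    push_cast; ring
  · have h := card_trace_eq_le (L := L) hd hcop hr he hde c
    have h2 : {x : L | Algebra.trace (ZMod p) L (aeval x f) = c}.ncard
        = (Finset.univ.filter fun x => T x = c).card := by
      rw [← Set.ncard_coe_finset]; simp [hT]
    rw [h2] at h
    calc _ ≤ ((p ^ (e + 1) * (p ^ e + 2 * f.natDegree + 2) : ℕ) : ℝ) := by exact_mod_cast h
      _ = _ := by push_cast; ring

/-- Square-root cancellation, with an unspecified constant, over extensions of even degree. -/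
theorem exists_norm_traceSum_le {ψ : AddChar (ZMod p) ℂ} (hψ : ψ ≠ 1)
    (hd : 0 < f.natDegree) (hcop : p.Coprime f.natDegree) :
    ∃ C : ℝ, ∀ s : ℕ, 0 < s →
      ‖traceSum (GaloisField p (2 * s)) ψ f‖ ≤ C * (p : ℝ) ^ s := by
  have hp1 : 1 < p := (Fact.out : p.Prime).one_lt
  have hp : (1 : ℝ) < p := by exact_mod_cast hp1
  set E := f.natDegree ^ 2 + 4 * f.natDegree + 2 with hE
  -- The first constant serves large `s`; the second makes the trivial bound `p ^ (2 * s)` enough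
  -- for the finitely many small `s`.
  refine ⟨max (p ^ 2 * (2 * f.natDegree + 2)) (p ^ (E + 1)), fun s hs => ?_⟩
  obtain ⟨e, rfl⟩ := Nat.exists_eq_succ_of_ne_zero hs.ne'
  have hr := GaloisField.finrank p (n := 2 * (e + 1)) (by omega)
  rcases lt_or_ge E e with hlt | hge
  · have h1 : e < p ^ e := Nat.lt_pow_self hp1
    have hde : f.natDegree ≤ p ^ e := by nlinarith
    have := norm_traceSum_le_of_finrank hψ hd hcop hr (by omega) hde
    refine this.trans ?_
    rw [← mul_assoc]
    gcongr
    exact le_max_left _ _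
  · refine (norm_traceSum_le ψ).trans ?_
    rw [← FiniteField.pow_finrank_eq_natCard p (GaloisField p (2 * (e + 1))), hr]
    push_cast
    rw [two_mul, pow_add]
    gcongr
    refine (pow_le_pow_right₀ hp.le ?_).trans (le_max_right _ _)
    omega

end TraceSums

/-! ### Power sums of roots and Newton's identities -/

section PowerSums

variable {F : Type*} [Field F]

/-- Minus `T` times the logarithmic derivative. -/
noncomputable def negLogDeriv (G : PowerSeries F) : PowerSeries F :=
  -(PowerSeries.X * PowerSeries.derivative F G) * G⁻¹

theorem negLogDeriv_mul_self {G : PowerSeries F} (h : PowerSeries.constantCoeff G ≠ 0) :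
    negLogDeriv G * G = -(PowerSeries.X * PowerSeries.derivative F G) := by
  rw [negLogDeriv, mul_assoc, PowerSeries.inv_mul_cancel G h, mul_one]

theorem eq_negLogDeriv {G N : PowerSeries F} (h : PowerSeries.constantCoeff G ≠ 0)
    (hN : N * G = -(PowerSeries.X * PowerSeries.derivative F G)) : N = negLogDeriv G := by
  rw [negLogDeriv, ← hN, mul_assoc, PowerSeries.mul_inv_cancel G h, mul_one]

theorem negLogDeriv_mul {G H : PowerSeries F} (hG : PowerSeries.constantCoeff G ≠ 0)
    (hH : PowerSeries.constantCoeff H ≠ 0) :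
    negLogDeriv (G * H) = negLogDeriv G + negLogDeriv H := by
  symm
  apply eq_negLogDeriv
  · rw [map_mul]; exact mul_ne_zero hG hH
  · rw [add_mul, ← mul_assoc, negLogDeriv_mul_self hG, mul_comm G H, ← mul_assoc,
      negLogDeriv_mul_self hH, Derivation.leibniz, smul_eq_mul, smul_eq_mul]
    ring

theorem coeff_zero_negLogDeriv (G : PowerSeries F) : PowerSeries.coeff 0 (negLogDeriv G) = 0 := by
  simp [negLogDeriv]

theorem coeff_neg_X_mul_derivative (G : PowerSeries F) (n : ℕ) :
    PowerSeries.coeff n (-(PowerSeries.X * PowerSeries.derivative F G))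
      = -(n * PowerSeries.coeff n G) := by
  cases n with
  | zero => simp
  | succ n =>
    rw [map_neg, PowerSeries.coeff_succ_X_mul, PowerSeries.coeff_derivative]
    push_cast; ring

/-- The sum of the `n`-th powers of the roots of a monic polynomial (for `n ≥ 1`), as an
expression in its coefficients. -/
noncomputable def powSum (g : F[X]) (n : ℕ) : F :=
  PowerSeries.coeff n (negLogDeriv (g.reverse : PowerSeries F))

theorem constantCoeff_reverse_ne_zero {g : F[X]} (hg : g ≠ 0) :
    PowerSeries.constantCoeff (g.reverse : PowerSeries F) ≠ 0 := by
  simpa using hg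

theorem powSum_mul {g h : F[X]} (hg : g ≠ 0) (hh : h ≠ 0) (n : ℕ) :
    powSum (g * h) n = powSum g n + powSum h n := by
  rw [powSum, reverse_mul_of_domain, Polynomial.coe_mul,
    negLogDeriv_mul (constantCoeff_reverse_ne_zero hg) (constantCoeff_reverse_ne_zero hh), map_add]
  rfl

theorem powSum_one (n : ℕ) : powSum (1 : F[X]) n = 0 := by
  have := powSum_mul (one_ne_zero (α := F[X])) (one_ne_zero (α := F[X])) n
  rw [mul_one] at this
  exact left_eq_add.mp this

/-- The reverse is `1 - aT`, whose `negLogDeriv` is the geometric series `aT / (1 - aT)`. It has no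
constant term, hence the condition on `n`. -/
theorem powSum_X_sub_C (a : F) {n : ℕ} (hn : n ≠ 0) : powSum (X - C a) n = a ^ n := by
  have hrev : (X - C a : F[X]).reverse = 1 - C a * X := by
    ext n
    rw [coeff_reverse, natDegree_X_sub_C]
    rcases n with _ | _ | n
    · simp [revAt_le]
    · simp [revAt_le, coeff_one]
    · rw [revAt_eq_self_of_lt (by omega)]
      simp [coeff_X, coeff_one]
  have hc : PowerSeries.constantCoeff ((1 - C a * X : F[X]) : PowerSeries F) ≠ 0 := by
    simp
  have : negLogDeriv ((1 - C a * X : F[X]) : PowerSeries F)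
      = PowerSeries.mk fun n => if n = 0 then 0 else a ^ n := by
    symm
    apply eq_negLogDeriv hc
    ext n
    rw [coeff_neg_X_mul_derivative]
    have e : ((1 - C a * X : F[X]) : PowerSeries F) = 1 - PowerSeries.C a * PowerSeries.X := by
      simp
    rw [e, mul_sub, mul_one, map_sub, mul_left_comm, PowerSeries.coeff_C_mul, map_sub,
      PowerSeries.coeff_C_mul]
    cases n with
    | zero => simp
    | succ n =>
      rw [PowerSeries.coeff_succ_mul_X]
      cases n with
      | zero => simp [PowerSeries.coeff_one, PowerSeries.coeff_X]
      | succ n => simp [PowerSeries.coeff_one, PowerSeries.coeff_X, pow_succ']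
  rw [powSum, hrev, this, PowerSeries.coeff_mk, if_neg hn]

theorem powSum_multiset_prod (s : Multiset F) {n : ℕ} (hn : n ≠ 0) :
    powSum (s.map fun a => X - C a).prod n = (s.map fun a => a ^ n).sum := by
  induction s using Multiset.induction_on with
  | empty => simp [powSum_one]
  | cons a s ih =>
    rw [Multiset.map_cons, Multiset.prod_cons, powSum_mul (X_sub_C_ne_zero a), ih,
      powSum_X_sub_C a hn, Multiset.map_cons, Multiset.sum_cons]
    exact (monic_multiset_prod_of_monic _ _ fun a _ => monic_X_sub_C a).ne_zero

theorem powSum_eq_sum_roots {g : F[X]} (hg : g.Monic) (hs : g.Splits) {n : ℕ} (hn : n ≠ 0) :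
    powSum g n = (g.roots.map fun a => a ^ n).sum := by
  conv_lhs => rw [hs.eq_prod_roots_of_monic hg]
  exact powSum_multiset_prod _ hn

theorem powSum_zero (g : F[X]) : powSum g 0 = 0 := coeff_zero_negLogDeriv _

/-- Newton's identities, read off from the coefficient of `Tⁿ` in `negLogDeriv G * G = -T G'`. -/
theorem powSum_rec {g : F[X]} (hg : g.Monic) (n : ℕ) :
    powSum g n = -(n * g.reverse.coeff n)
      - ∑ i ∈ Finset.range n, powSum g i * g.reverse.coeff (n - i) := by
  have h := congrArg (PowerSeries.coeff n)
    (negLogDeriv_mul_self (constantCoeff_reverse_ne_zero hg.ne_zero))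
  rw [coeff_neg_X_mul_derivative, PowerSeries.coeff_mul,
    Finset.Nat.sum_antidiagonal_eq_sum_range_succ_mk, Finset.sum_range_succ] at h
  simp only [Polynomial.coeff_coe, Nat.sub_self, coeff_zero_reverse, hg.leadingCoeff,
    mul_one] at h
  rw [← h]
  simp [powSum]

theorem powSum_map {F' : Type*} [Field F'] (φ : F →+* F') {g : F[X]} (hg : g.Monic) (n : ℕ) :
    powSum (g.map φ) n = φ (powSum g n) := by
  have hrev : ∀ i, (g.map φ).reverse.coeff i = φ (g.reverse.coeff i) := by
    intro i
    rw [coeff_reverse, coeff_reverse, natDegree_map, coeff_map]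
  induction n using Nat.strong_induction_on with
  | _ n ih =>
    rw [powSum_rec (hg.map φ), powSum_rec hg, hrev, map_sub, map_neg, map_mul, map_natCast, map_sum]
    congr 1
    refine Finset.sum_congr rfl fun i hi => ?_
    rw [ih i (Finset.mem_range.mp hi), hrev, map_mul]

/-- The effect on power sums of changing the `d`-th highest coefficient. -/
theorem powSum_eq_sub {g h : F[X]} (hg : g.Monic) (hh : h.Monic) {d : ℕ}
    (heq : ∀ i < d, g.reverse.coeff i = h.reverse.coeff i) :
    (∀ i < d, powSum h i = powSum g i) ∧
      powSum h d = powSum g d - d * (h.reverse.coeff d - g.reverse.coeff d) := by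
  have hsum : ∀ n ≤ d, (∀ i < n, powSum h i = powSum g i) →
      ∑ i ∈ Finset.range n, powSum h i * h.reverse.coeff (n - i)
        = ∑ i ∈ Finset.range n, powSum g i * g.reverse.coeff (n - i) := by
    intro n hn ih
    refine Finset.sum_congr rfl fun i hi => ?_
    rw [Finset.mem_range] at hi
    rcases Nat.eq_zero_or_pos i with rfl | hi0
    · simp [powSum_zero]
    · rw [ih i hi, heq (n - i) (by omega)]
  have hlow : ∀ i < d, powSum h i = powSum g i := by
    intro n
    induction n using Nat.strong_induction_on with
    | _ n ih =>
      intro hn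
      rw [powSum_rec hg, powSum_rec hh, heq n hn,
        hsum n hn.le fun i hi => ih i hi (hi.trans hn)]
  refine ⟨hlow, ?_⟩
  rw [powSum_rec hg, powSum_rec hh, hsum d le_rfl hlow]
  ring

end PowerSums

/-! ### Traces as power sums -/

section TracePowSum

-- On `K(x)` the trace is the sum over embeddings, which correspond to the roots of the minimal
-- polynomial, distinct by separability. The degree of `L` over `K(x)` enters by transitivity.
open IntermediateField in
theorem trace_pow_eq_powSum {K L : Type*} [Field K] [Field L] [Algebra K L]
    [FiniteDimensional K L] [Algebra.IsSeparable K L] (x : L) {n : ℕ} (hn : n ≠ 0) :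
    Algebra.trace K L (x ^ n) = Module.finrank K⟮x⟯ L * powSum (minpoly K x) n := by
  classical
  have hx : IsIntegral K x := Algebra.IsSeparable.isIntegral K x
  let E := AlgebraicClosure K
  let pb := adjoin.powerBasis hx
  have hgen : minpoly K pb.gen = minpoly K x := by
    rw [adjoin.powerBasis_gen, minpoly_gen]
  have hxn : x ^ n = algebraMap K⟮x⟯ L (pb.gen ^ n) := by
    rw [map_pow]; congr 1
  have : Algebra.IsSeparable K K⟮x⟯ := Algebra.isSeparable_tower_bot_of_isSeparable K K⟮x⟯ L
  have h1 : Algebra.trace K L (x ^ n)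
      = Module.finrank K⟮x⟯ L * Algebra.trace K K⟮x⟯ (pb.gen ^ n) := by
    rw [hxn, ← Algebra.trace_trace (S := K⟮x⟯), Algebra.trace_algebraMap, map_nsmul, nsmul_eq_mul]
  rw [h1]
  congr 1
  apply (algebraMap K E).injective
  rw [trace_eq_sum_embeddings E, ← powSum_map _ (minpoly.monic hx),
    powSum_eq_sum_roots ((minpoly.monic hx).map _) (IsAlgClosed.splits _) hn]
  have hnd : ((minpoly K x).map (algebraMap K E)).roots.Nodup :=
    nodup_roots (Polynomial.Separable.map (Algebra.IsSeparable.isSeparable K x))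
  rw [Fintype.sum_equiv pb.liftEquiv' (fun σ => σ (pb.gen ^ n))
    (fun y => (y : E) ^ n) (fun σ => by simp [PowerBasis.liftEquiv'_apply_coe])]
  rw [Finset.sum_mem_multiset _ _ (fun y => (y : E) ^ n) (fun y => rfl),
    Finset.sum_eq_multiset_sum, Multiset.toFinset_val, hgen, aroots,
    Multiset.dedup_eq_self.mpr hnd]

end TracePowSum

/-! ### Completely multiplicative functions of monic polynomials -/

section EulerProduct

theorem map_pow_of_monic {F : Type*} [Field F] {lam : F[X] → ℂ} (h1 : lam 1 = 1)
    (hmul : ∀ g h : F[X], g.Monic → h.Monic → lam (g * h) = lam g * lam h)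
    {P : F[X]} (hP : P.Monic) (k : ℕ) : lam (P ^ k) = lam P ^ k := by
  induction k with
  | zero => simpa
  | succ k ih => rw [pow_succ, hmul _ _ (hP.pow k) hP, ih, pow_succ]

variable (F : Type*) [Field F] [Finite F]

theorem finite_setOf_monic_natDegree_le (m : ℕ) :
    {g : F[X] | g.Monic ∧ g.natDegree ≤ m}.Finite := by
  rw [← Set.finite_coe_iff]
  refine Finite.of_injective
    (fun (g : {g : F[X] | g.Monic ∧ g.natDegree ≤ m}) (i : Fin (m + 1)) => g.1.coeff i) ?_
  rintro ⟨g, _, hg⟩ ⟨h, _, hh⟩ hgh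
  rw [Subtype.mk_eq_mk]
  ext i
  rcases lt_or_ge i (m + 1) with hi | hi
  · exact congrFun hgh ⟨i, hi⟩
  · rw [coeff_eq_zero_of_natDegree_lt (hg.trans_lt hi),
      coeff_eq_zero_of_natDegree_lt (hh.trans_lt hi)]

/-- The monic polynomials of degree `m`. -/
noncomputable def monics (m : ℕ) : Finset F[X] :=
  ((finite_setOf_monic_natDegree_le F m).subset
    (show {g : F[X] | g.Monic ∧ g.natDegree = m} ⊆ _ from fun _ h => ⟨h.1, h.2.le⟩)).toFinset

/-- The monic irreducible polynomials of degree at most `m`. -/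
noncomputable def monicIrreds (m : ℕ) : Finset F[X] :=
  ((finite_setOf_monic_natDegree_le F m).subset
    (show {g : F[X] | (g.Monic ∧ g.natDegree ≤ m) ∧ Irreducible g} ⊆ _ from
      fun _ h => h.1)).toFinset

variable {F}

theorem mem_monics {m : ℕ} {g : F[X]} : g ∈ monics F m ↔ g.Monic ∧ g.natDegree = m := by
  simp [monics]

theorem mem_monicIrreds {m : ℕ} {g : F[X]} :
    g ∈ monicIrreds F m ↔ (g.Monic ∧ g.natDegree ≤ m) ∧ Irreducible g := by
  simp [monicIrreds]

-- The analogue of `log n = ∑_{d ∣ n} Λ(d)`: `P` is counted once for each `k` up to its multiplicity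
-- in `g`.
open UniqueFactorizationMonoid in
theorem natDegree_eq_sum_prime_powers {m : ℕ} {g : F[X]} (hg : g ∈ monics F m) [DecidableEq F[X]]
    [DecidableRel fun a b : F[X] => a ∣ b] :
    m = ∑ P ∈ monicIrreds F m, ∑ k ∈ Finset.Icc 1 m, if P ^ k ∣ g then P.natDegree else 0 := by
  classical
  obtain ⟨hmon, hdeg⟩ := mem_monics.mp hg
  have hg0 := hmon.ne_zero
  have hcount : ∀ P ∈ monicIrreds F m,
      ∑ k ∈ Finset.Icc 1 m, (if P ^ k ∣ g then P.natDegree else 0)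
        = (normalizedFactors g).count P * P.natDegree := by
    intro P hP
    obtain ⟨⟨hPm, -⟩, hirr⟩ := mem_monicIrreds.mp hP
    have hdvd : ∀ k, P ^ k ∣ g ↔ k ≤ (normalizedFactors g).count P := by
      intro k
      rw [pow_dvd_iff_le_emultiplicity, emultiplicity_eq_count_normalizedFactors hirr hg0,
        hPm.normalize_eq_self, Nat.cast_le]
    have hle : (normalizedFactors g).count P ≤ m := by
      have h1 := natDegree_le_of_dvd ((hdvd _).mpr le_rfl) hg0
      rw [natDegree_pow, hdeg] at h1
      exact (Nat.le_mul_of_pos_right _ hirr.natDegree_pos).trans h1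
    rw [← Finset.sum_filter, Finset.sum_const, smul_eq_mul]
    congr 1
    have : (Finset.Icc 1 m).filter (fun k => P ^ k ∣ g)
        = Finset.Icc 1 ((normalizedFactors g).count P) := by
      ext k
      simp only [Finset.mem_filter, Finset.mem_Icc, hdvd]
      omega
    rw [this]; simp
  rw [Finset.sum_congr rfl hcount]
  have hprod : (normalizedFactors g).prod = g := by
    rw [prod_normalizedFactors_eq hg0, hmon.normalize_eq_self]
  have hmonic : ∀ P ∈ normalizedFactors g, P.Monic := by
    intro P hP
    have := normalize_normalized_factor P hP
    rw [← this]
    exact monic_normalize (irreducible_of_normalized_factor P hP).ne_zero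
  have hsub : (normalizedFactors g).toFinset ⊆ monicIrreds F m := by
    intro P hP
    rw [Multiset.mem_toFinset] at hP
    refine mem_monicIrreds.mpr ⟨⟨hmonic P hP, ?_⟩, irreducible_of_normalized_factor P hP⟩
    rw [← hdeg]
    exact natDegree_le_of_dvd (dvd_of_mem_normalizedFactors hP) hg0
  calc m = ((normalizedFactors g).map natDegree).sum := by
        rw [← natDegree_multiset_prod_of_monic _ hmonic, hprod, hdeg]
    _ = ∑ P ∈ (normalizedFactors g).toFinset, (normalizedFactors g).count P * P.natDegree := by
        rw [Finset.sum_multiset_map_count]; rfl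
    _ = _ := by
        refine Finset.sum_subset hsub fun P _ hP => ?_
        rw [Multiset.mem_toFinset, ← Multiset.count_eq_zero] at hP
        rw [hP, zero_mul]

variable {lam : F[X] → ℂ}

/-- The sum of a function over the monic polynomials of degree `m`. -/
noncomputable def monicSum (lam : F[X] → ℂ) (m : ℕ) : ℂ := ∑ g ∈ monics F m, lam g

theorem monics_zero : monics F 0 = {1} := by
  ext g
  rw [mem_monics, Finset.mem_singleton]
  constructor
  · rintro ⟨h, h0⟩; exact h.natDegree_eq_zero.mp h0
  · rintro rfl; simp

theorem sum_monics_dvd (hmul : ∀ g h : F[X], g.Monic → h.Monic → lam (g * h) = lam g * lam h)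
    {P : F[X]} (hP : P.Monic) (m : ℕ) [DecidableRel fun a b : F[X] => a ∣ b] :
    ∑ g ∈ monics F m with P ∣ g, lam g
      = if P.natDegree ≤ m then lam P * monicSum lam (m - P.natDegree) else 0 := by
  classical
  split_ifs with hle
  · rw [monicSum, Finset.mul_sum]
    symm
    refine Finset.sum_bij (fun h _ => P * h) ?_ ?_ ?_ ?_
    · intro h hh
      obtain ⟨h1, h2⟩ := mem_monics.mp hh
      rw [Finset.mem_filter, mem_monics]
      refine ⟨⟨hP.mul h1, ?_⟩, dvd_mul_right _ _⟩
      rw [hP.natDegree_mul h1, h2]; omega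
    · intro h _ h' _ e
      exact mul_left_cancel₀ hP.ne_zero e
    · intro g hg
      obtain ⟨hg1, h, rfl⟩ := Finset.mem_filter.mp hg
      obtain ⟨h1, h2⟩ := mem_monics.mp hg1
      have hh : h.Monic := hP.of_mul_monic_left h1
      refine ⟨h, mem_monics.mpr ⟨hh, ?_⟩, rfl⟩
      rw [hP.natDegree_mul hh] at h2
      omega
    · intro h hh
      exact (hmul P h hP (mem_monics.mp hh).1).symm
  · rw [Finset.filter_false_of_mem, Finset.sum_empty]
    intro g hg hd
    obtain ⟨h1, h2⟩ := mem_monics.mp hg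
    exact hle (h2 ▸ natDegree_le_of_dvd hd h1.ne_zero)

/-- The logarithmic derivative of the Euler product of a completely multiplicative function. -/
theorem mul_monicSum_eq (h1 : lam 1 = 1)
    (hmul : ∀ g h : F[X], g.Monic → h.Monic → lam (g * h) = lam g * lam h) (m : ℕ) :
    m * monicSum lam m = ∑ r ∈ Finset.Icc 1 m,
      (∑ P ∈ monicIrreds F m with P.natDegree ∣ r,
        P.natDegree * lam P ^ (r / P.natDegree)) * monicSum lam (m - r) := by
  classical
  -- Write `m = deg g` as a sum over prime powers dividing `g`, then exchange sums: the multiples of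
  -- `P ^ k` contribute `lam P ^ k` times a shorter sum.
  have step : (m : ℂ) * monicSum lam m = ∑ P ∈ monicIrreds F m, ∑ k ∈ Finset.Icc 1 m,
      if k * P.natDegree ≤ m then
        P.natDegree * lam P ^ k * monicSum lam (m - k * P.natDegree) else 0 := by
    rw [monicSum, Finset.mul_sum]
    have : ∀ g ∈ monics F m, (m : ℂ) * lam g = ∑ P ∈ monicIrreds F m, ∑ k ∈ Finset.Icc 1 m,
        if P ^ k ∣ g then (P.natDegree : ℂ) * lam g else 0 := by
      intro g hg
      conv_lhs => rw [natDegree_eq_sum_prime_powers hg]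
      push_cast
      simp only [Finset.sum_mul, ite_mul, zero_mul]
    rw [Finset.sum_congr rfl this, Finset.sum_comm]
    refine Finset.sum_congr rfl fun P hP => ?_
    have hPm := (mem_monicIrreds.mp hP).1.1
    rw [Finset.sum_comm]
    refine Finset.sum_congr rfl fun k _ => ?_
    rw [← Finset.sum_filter, ← Finset.mul_sum, sum_monics_dvd hmul (hPm.pow k), natDegree_pow,
      map_pow_of_monic h1 hmul hPm]
    split_ifs
    · ring
    · simp
  rw [step]
  simp only [Finset.sum_mul, Finset.sum_filter, ite_mul, zero_mul]
  refine Eq.trans ?_ Finset.sum_comm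
  refine Finset.sum_congr rfl fun P hP => ?_
  have hpos : 0 < P.natDegree := (mem_monicIrreds.mp hP).2.natDegree_pos
  rw [← Finset.sum_filter, ← Finset.sum_filter]
  refine Finset.sum_bij (fun k _ => k * P.natDegree) ?_ ?_ ?_ ?_
  · intro k hk
    simp only [Finset.mem_filter, Finset.mem_Icc] at hk ⊢
    exact ⟨⟨Nat.mul_pos hk.1.1 hpos, hk.2⟩, dvd_mul_left _ _⟩
  · intro k _ k' _ e
    exact Nat.eq_of_mul_eq_mul_right hpos e
  · intro r hr
    simp only [Finset.mem_filter, Finset.mem_Icc] at hr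
    obtain ⟨⟨hr1, hr2⟩, k, rfl⟩ := hr
    refine ⟨k, ?_, mul_comm _ _⟩
    simp only [Finset.mem_filter, Finset.mem_Icc]
    have : k ≤ P.natDegree * k := Nat.le_mul_of_pos_left _ hpos
    refine ⟨⟨Nat.pos_of_ne_zero ?_, by omega⟩, by rwa [mul_comm]⟩
    rintro rfl; simp at hr1
  · intro k _
    simp only [Nat.mul_div_cancel _ hpos]

end EulerProduct

/-! ### Growth of power sums bounds the individual terms -/

section PowerSumGrowth

/-- `w ↦ 1 / (1 - w)` maps the unit disc to a half plane. Only positivity of the real part is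
needed: other terms cannot cancel the pole of the dominant one. -/
theorem half_le_re_inv_one_sub {w : ℂ} (hw : ‖w‖ < 1) : 1 / 2 ≤ ((1 - w)⁻¹).re := by
  have h1 : (1 - w) ≠ 0 := by
    intro h
    rw [sub_eq_zero] at h
    simp [← h] at hw
  have h2 : 0 < Complex.normSq (1 - w) := Complex.normSq_pos.mpr h1
  rw [Complex.inv_re, div_le_div_iff₀ (by norm_num) h2]
  have h3 : w.re ^ 2 + w.im ^ 2 < 1 := by
    have := Complex.sq_norm w
    rw [Complex.normSq_apply] at this
    nlinarith [norm_nonneg w]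
  simp only [Complex.normSq_apply, Complex.sub_re, Complex.one_re, Complex.sub_im,
    Complex.one_im]
  nlinarith

/-- If the power sums of a multiset of complex numbers grow at most like `R ^ n`, then all
its elements are bounded by `R`. -/
theorem norm_le_of_norm_powSum_le {s : Multiset ℂ} {R C : ℝ} (hR : 0 < R)
    (h : ∀ n : ℕ, 0 < n → ‖(s.map fun z => z ^ n).sum‖ ≤ C * R ^ n) {z : ℂ} (hz : z ∈ s) :
    ‖z‖ ≤ R := by
  classical
  obtain ⟨w, hw, hmax⟩ := s.toFinset.exists_max_image (fun z => ‖z‖) ⟨z, by simpa using hz⟩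
  rw [Multiset.mem_toFinset] at hw
  refine (hmax z (by simpa using hz)).trans ?_
  by_contra! hlt
  have hw0 : 0 < ‖w‖ := hR.trans hlt
  have hwne : w ≠ 0 := norm_pos_iff.mp hw0
  set ρ := R / ‖w‖ with hρ
  have hρ0 : 0 < ρ := div_pos hR hw0
  have hρ1 : ρ < 1 := (div_lt_one hw0).mpr hlt
  have hC : 0 ≤ C := by
    have := (norm_nonneg _).trans (h 1 one_pos)
    rw [pow_one] at this
    exact nonneg_of_mul_nonneg_left this hR
  set B := (Multiset.card s : ℝ) + C * (1 - ρ)⁻¹ with hB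
  have hB0 : 0 ≤ B := by
    have : 0 < 1 - ρ := by linarith
    positivity
  have key : ∀ t : ℝ, 0 < t → t < 1 → (1 - t)⁻¹ ≤ B := by
    intro t ht0 ht1
    -- The generating function of the power sums is evaluated along the ray to the pole `1 / w` of
    -- an element `w` of largest modulus. If `‖w‖ > R` the series stays bounded by `B`, yet `w`
    -- contributes at least `1 / (1 - t)`.
    set T : ℂ := t / w with hT
    have hTn : ‖T‖ = t / ‖w‖ := by rw [hT, norm_div, Complex.norm_real, Real.norm_of_nonneg ht0.le]
    have hnorm : ∀ z ∈ s.toFinset, ‖z * T‖ < 1 := by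
      intro z hz
      rw [norm_mul, hTn, mul_div_assoc', div_lt_one hw0]
      have := hmax z hz
      nlinarith [norm_nonneg z]
    have hs : HasSum (fun n : ℕ => ∑ z ∈ s.toFinset, (s.count z : ℂ) * (z * T) ^ n)
        (∑ z ∈ s.toFinset, (s.count z : ℂ) * (1 - z * T)⁻¹) :=
      hasSum_sum fun z hz => (hasSum_geometric_of_norm_lt_one (hnorm z hz)).mul_left _
    have hterm : ∀ n : ℕ, ∑ z ∈ s.toFinset, (s.count z : ℂ) * (z * T) ^ n
        = (s.map fun z => z ^ n).sum * T ^ n := by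
      intro n
      rw [Finset.sum_multiset_map_count, Finset.sum_mul]
      refine Finset.sum_congr rfl fun z _ => ?_
      rw [mul_pow, nsmul_eq_mul, mul_assoc]
    have hbound : ∀ n : ℕ, ‖∑ z ∈ s.toFinset, (s.count z : ℂ) * (z * T) ^ n‖
        ≤ (if n = 0 then (Multiset.card s : ℝ) else 0) + C * ρ ^ n := by
      intro n
      rw [hterm, norm_mul, norm_pow, hTn]
      rcases Nat.eq_zero_or_pos n with rfl | hn
      · simp [hC]
      · rw [if_neg hn.ne', zero_add]
        calc _ ≤ C * R ^ n * (t / ‖w‖) ^ n := by gcongr; exact h n hn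
          _ ≤ C * R ^ n * (1 / ‖w‖) ^ n := by gcongr
          _ = C * ρ ^ n := by rw [hρ, mul_assoc, ← mul_pow, mul_one_div]
    have hsum2 : HasSum (fun n : ℕ => (if n = 0 then (Multiset.card s : ℝ) else 0) + C * ρ ^ n)
        B :=
      (hasSum_ite_eq 0 _).add ((hasSum_geometric_of_lt_one hρ0.le hρ1).mul_left C)
    have hle : ‖∑ z ∈ s.toFinset, (s.count z : ℂ) * (1 - z * T)⁻¹‖ ≤ B := by
      rw [← hs.tsum_eq]
      exact tsum_of_norm_bounded hsum2 hbound
    refine le_trans ?_ ((Complex.re_le_norm _).trans hle)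
    have hwT : w * T = t := by rw [hT]; field_simp
    rw [Complex.re_sum]
    calc (1 - t)⁻¹ ≤ ((s.count w : ℂ) * (1 - w * T)⁻¹).re := by
          rw [hwT, ← Complex.ofReal_natCast, ← Complex.ofReal_one, ← Complex.ofReal_sub,
            ← Complex.ofReal_inv, ← Complex.ofReal_mul, Complex.ofReal_re]
          have : (1 : ℝ) ≤ s.count w := by exact_mod_cast Multiset.one_le_count_iff_mem.mpr hw
          have h2 : 0 ≤ (1 - t)⁻¹ := inv_nonneg.mpr (by linarith)
          nlinarith
      _ ≤ _ := by
          refine Finset.single_le_sum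
            (f := fun z => ((s.count z : ℂ) * (1 - z * T)⁻¹).re) (fun z hz => ?_)
            (Multiset.mem_toFinset.mpr hw)
          have := half_le_re_inv_one_sub (hnorm z hz)
          rw [← Complex.ofReal_natCast, Complex.re_ofReal_mul]
          have : (0 : ℝ) ≤ s.count z := Nat.cast_nonneg _
          nlinarith
  -- At this `t` the inequality reads `B + 2 ≤ B`.
  have := key (1 - (B + 2)⁻¹) (by
    have : (B + 2)⁻¹ ≤ 2⁻¹ := inv_anti₀ (by norm_num) (by linarith)
    norm_num at this ⊢; linarith) (by
    have : 0 < (B + 2)⁻¹ := by positivity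
    linarith)
  rw [sub_sub_cancel, inv_inv] at this
  linarith

end PowerSumGrowth

/-! ### The L-function of an additive character composed with a polynomial -/

section LFunction

variable {p : ℕ} [Fact p.Prime]

/-- The completely multiplicative function `g ↦ ψ(∑ f(α))`, the sum over the roots `α` of `g`. -/
noncomputable def twist (ψ : AddChar (ZMod p) ℂ) (f g : (ZMod p)[X]) : ℂ :=
  ψ (∑ k ∈ Finset.range (f.natDegree + 1), f.coeff k * powSum g k)

variable {ψ : AddChar (ZMod p) ℂ} {f : (ZMod p)[X]}

theorem twist_one : twist ψ f 1 = 1 := by simp [twist, powSum_one]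

theorem twist_mul (g h : (ZMod p)[X]) (hg : g.Monic) (hh : h.Monic) :
    twist ψ f (g * h) = twist ψ f g * twist ψ f h := by
  simp only [twist, powSum_mul hg.ne_zero hh.ne_zero, mul_add, Finset.sum_add_distrib,
    AddChar.map_add_eq_mul]

/-- With `d = deg f`, changing the `d`-th highest coefficient of `g` by `δ` leaves the power sums
below `d` alone and moves the `d`-th by `-d * δ`; higher power sums do not occur in `twist`. -/
theorem twist_add_monomial (hd : 0 < f.natDegree) {m : ℕ} (hm : f.natDegree ≤ m)
    {g : (ZMod p)[X]} (hg : g ∈ monics (ZMod p) m) (δ : ZMod p) :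
    g + C δ * X ^ (m - f.natDegree) ∈ monics (ZMod p) m ∧
    twist ψ f (g + C δ * X ^ (m - f.natDegree))
      = ψ (-(f.leadingCoeff * f.natDegree * δ)) * twist ψ f g := by
  obtain ⟨hmon, hdeg⟩ := mem_monics.mp hg
  set d := f.natDegree with hddef
  have hlt : (C δ * X ^ (m - d) : (ZMod p)[X]).degree < g.degree := by
    rw [degree_eq_natDegree hmon.ne_zero, hdeg]
    refine (degree_C_mul_X_pow_le _ _).trans_lt ?_
    exact_mod_cast (by omega : m - d < m)
  have hmon' : (g + C δ * X ^ (m - d)).Monic := hmon.add_of_left hlt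
  have hdeg' : (g + C δ * X ^ (m - d)).natDegree = m := by
    rw [natDegree_eq_of_degree_eq (degree_add_eq_left_of_degree_lt hlt), hdeg]
  refine ⟨mem_monics.mpr ⟨hmon', hdeg'⟩, ?_⟩
  have hrev : ∀ i ≤ m, (g + C δ * X ^ (m - d)).reverse.coeff i
      = g.reverse.coeff i + if i = d then δ else 0 := by
    intro i hi
    rw [coeff_reverse, coeff_reverse, hdeg, hdeg', revAt_le hi, coeff_add, coeff_C_mul_X_pow]
    congr 1
    by_cases h : i = d
    · simp [h]
    · rw [if_neg h, if_neg (by omega)]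
  obtain ⟨h1, h2⟩ := powSum_eq_sub hmon hmon' (d := d) (fun i hi => by
    rw [hrev i (by omega), if_neg hi.ne, add_zero])
  rw [hrev d hm, if_pos rfl, add_sub_cancel_left] at h2
  rw [twist, twist, ← AddChar.map_add_eq_mul]
  congr 1
  rw [Finset.sum_range_succ, Finset.sum_range_succ, h2,
    Finset.sum_congr rfl fun i hi => by rw [h1 i (Finset.mem_range.mp hi)],
    ← hddef, leadingCoeff, ← hddef]
  ring

/-- The shift of `twist_add_monomial` permutes the monic polynomials of degree `m` and multiplies
the sum by `ψ c`. Because `deg f` is invertible modulo `p`, `δ` can be chosen with `ψ c ≠ 1`. Hence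
the `L`-function is a polynomial. -/
theorem monicSum_twist_eq_zero (hψ : ψ ≠ 1) (hd : 0 < f.natDegree)
    (hcop : p.Coprime f.natDegree) {m : ℕ} (hm : f.natDegree ≤ m) :
    monicSum (twist ψ f) m = 0 := by
  obtain ⟨c, hc⟩ : ∃ c, ψ c ≠ 1 := by
    by_contra! h
    exact hψ (DFunLike.ext _ _ fun c => by rw [h c, AddChar.one_apply])
  have hne : f.leadingCoeff * (f.natDegree : ZMod p) ≠ 0 := by
    refine mul_ne_zero (leadingCoeff_ne_zero.mpr (by rintro rfl; simp at hd)) ?_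
    rw [Ne, ZMod.natCast_eq_zero_iff]
    exact fun h => (Fact.out : p.Prime).one_lt.ne' (Nat.eq_one_of_dvd_coprimes hcop dvd_rfl h)
  set δ := -c / (f.leadingCoeff * (f.natDegree : ZMod p)) with hδ
  have hval : -(f.leadingCoeff * f.natDegree * δ) = c := by
    rw [hδ, mul_div_cancel₀ _ hne, neg_neg]
  have heq : monicSum (twist ψ f) m = ψ c * monicSum (twist ψ f) m := by
    conv_rhs => rw [monicSum, Finset.mul_sum]
    symm
    refine Finset.sum_bij (fun g _ => g + C δ * X ^ (m - f.natDegree))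
      (fun g hg => (twist_add_monomial (ψ := ψ) hd hm hg δ).1)
      (fun g _ g' _ h => add_right_cancel h) (fun g hg => ?_) (fun g hg => ?_)
    · refine ⟨g + C (-δ) * X ^ (m - f.natDegree), (twist_add_monomial (ψ := ψ) hd hm hg (-δ)).1, ?_⟩
      simp
    · rw [(twist_add_monomial hd hm hg δ).2, hval]
  have : (1 - ψ c) * monicSum (twist ψ f) m = 0 := by linear_combination heq
  exact (mul_eq_zero.mp this).resolve_left (sub_ne_zero.mpr hc.symm)

/-- Roots of `P` are embeddings of `𝔽ₚ[X]/(P)`, and a finite field has as many embeddings as its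
degree into an extension of degree divisible by it. -/
theorem card_minpoly_eq {r : ℕ} (hr : r ≠ 0) [Fintype (GaloisField p r)]
    [DecidableEq (ZMod p)[X]] {P : (ZMod p)[X]} (hP : P.Monic) (hirr : Irreducible P)
    (hdvd : P.natDegree ∣ r) :
    (Finset.univ.filter fun x : GaloisField p r => minpoly (ZMod p) x = P).card
      = P.natDegree := by
  classical
  have : Fact (Irreducible P) := ⟨hirr⟩
  have : Module.Finite (ZMod p) (AdjoinRoot P) := hP.finite_adjoinRoot
  have hfr : Module.finrank (ZMod p) (AdjoinRoot P) = P.natDegree :=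
    finrank_quotient_span_eq_natDegree
  have h := FiniteField.natCard_algHom_of_finrank_dvd (F := ZMod p) (K := AdjoinRoot P)
    (L := GaloisField p r) (by rwa [hfr, GaloisField.finrank p hr])
  rw [hfr, Nat.card_congr (AdjoinRoot.equiv _ _ P hP.ne_zero)] at h
  rw [← h, Nat.subtype_card]
  intro x
  rw [Finset.mem_filter, mem_aroots]
  simp only [Finset.mem_univ, true_and]
  constructor
  · rintro rfl
    exact ⟨hP.ne_zero, minpoly.aeval _ x⟩
  · rintro ⟨-, hx⟩
    exact (minpoly.eq_of_irreducible_of_monic hirr hx hP).symm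

/-- The constant term must vanish because `powSum _ 0` is `0`, whereas the trace of `x ^ 0` is `r`.
-/
theorem trace_aeval_eq (h0 : f.coeff 0 = 0) {r : ℕ} (hr : r ≠ 0) (x : GaloisField p r) :
    ψ (Algebra.trace (ZMod p) (GaloisField p r) (aeval x f))
      = twist ψ f (minpoly (ZMod p) x) ^ (r / (minpoly (ZMod p) x).natDegree) := by
  have hfin : Module.finrank (IntermediateField.adjoin (ZMod p) {x}) (GaloisField p r)
      = r / (minpoly (ZMod p) x).natDegree := by
    have h1 := Module.finrank_mul_finrank (ZMod p) (IntermediateField.adjoin (ZMod p) {x})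
      (GaloisField p r)
    rw [GaloisField.finrank p hr, IntermediateField.adjoin.finrank (.of_finite _ x)] at h1
    exact (Nat.div_eq_of_eq_mul_right (minpoly.natDegree_pos (.of_finite _ x)) h1.symm).symm
  rw [twist, ← AddChar.map_nsmul_eq_pow, aeval_eq_sum_range, map_sum]
  congr 1
  rw [Finset.smul_sum]
  refine Finset.sum_congr rfl fun k _ => ?_
  rw [map_smul, smul_eq_mul]
  rcases Nat.eq_zero_or_pos k with rfl | hk
  · simp [h0]
  · rw [trace_pow_eq_powSum x hk.ne', hfin, nsmul_eq_mul]; ring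

theorem traceSum_eq_sum_monicIrreds (h0 : f.coeff 0 = 0) {r m : ℕ} (hr : r ≠ 0) (hrm : r ≤ m) :
    traceSum (GaloisField p r) ψ f = ∑ P ∈ monicIrreds (ZMod p) m with P.natDegree ∣ r,
      P.natDegree * twist ψ f P ^ (r / P.natDegree) := by
  classical
  have := Fintype.ofFinite (GaloisField p r)
  rw [traceSum, finsum_eq_sum_of_fintype, ← Finset.sum_fiberwise_of_maps_to
    (g := fun x => minpoly (ZMod p) x)
    (t := (monicIrreds (ZMod p) m).filter fun P => P.natDegree ∣ r)]
  · refine Finset.sum_congr rfl fun P hP => ?_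
    obtain ⟨hP1, hdvd⟩ := Finset.mem_filter.mp hP
    obtain ⟨⟨hmon, -⟩, hirr⟩ := mem_monicIrreds.mp hP1
    rw [Finset.sum_congr rfl (g := fun _ => twist ψ f P ^ (r / P.natDegree))
      (fun x hx => by rw [trace_aeval_eq h0 hr, (Finset.mem_filter.mp hx).2])]
    rw [Finset.sum_const, card_minpoly_eq hr hmon hirr hdvd, nsmul_eq_mul]
  · intro x _
    have hx : IsIntegral (ZMod p) x := .of_finite _ x
    have hd : (minpoly (ZMod p) x).natDegree ∣ r :=
      (minpoly.degree_dvd hx).trans (GaloisField.finrank p hr).dvd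
    rw [Finset.mem_filter, mem_monicIrreds]
    exact ⟨⟨⟨minpoly.monic hx, (Nat.le_of_dvd (Nat.pos_of_ne_zero hr) hd).trans hrm⟩,
      minpoly.irreducible hx⟩, hd⟩

/-- The exponential sums over extension fields are power sums of at most `deg f - 1` numbers. -/
theorem exists_traceSum_eq_powSum (hψ : ψ ≠ 1) (h0 : f.coeff 0 = 0) (hd : 0 < f.natDegree)
    (hcop : p.Coprime f.natDegree) :
    ∃ s : Multiset ℂ, Multiset.card s = f.natDegree - 1 ∧ ∀ r ≠ 0,
      traceSum (GaloisField p r) ψ f = -(s.map fun z => z ^ r).sum := by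
  set a := monicSum (twist ψ f) with ha
  set d := f.natDegree with hddef
  have ha0 : a 0 = 1 := by rw [ha, monicSum, monics_zero, Finset.sum_singleton, twist_one]
  -- The reverse of `h` is the `L`-function, so the roots of `h` are its reciprocal zeros; `h` is
  -- monic because `a 0 = 1`.
  set h : ℂ[X] := ∑ i ∈ Finset.range d, C (a i) * X ^ (d - 1 - i) with hh
  have hcoeff : ∀ j < d, h.coeff (d - 1 - j) = a j := by
    intro j hj
    rw [hh, finsetSum_coeff, Finset.sum_eq_single j]
    · simp
    · intro i hi hij
      rw [Finset.mem_range] at hi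
      rw [coeff_C_mul_X_pow, if_neg (by omega)]
    · intro hj'; exact absurd (Finset.mem_range.mpr hj) hj'
  have hdeg_le : h.natDegree ≤ d - 1 := by
    refine natDegree_sum_le_of_forall_le _ _ fun i _ => ?_
    exact (natDegree_C_mul_X_pow_le _ _).trans (by omega)
  have hc1 : h.coeff (d - 1) = 1 := by have := hcoeff 0 hd; rwa [Nat.sub_zero, ha0] at this
  have hmon : h.Monic := monic_of_natDegree_le_of_coeff_eq_one _ hdeg_le hc1
  have hdeg : h.natDegree = d - 1 :=
    le_antisymm hdeg_le (le_natDegree_of_ne_zero (by rw [hc1]; exact one_ne_zero))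
  have hrev : ∀ i, h.reverse.coeff i = a i := by
    intro i
    rcases lt_or_ge i d with hi | hi
    · rw [coeff_reverse, hdeg, revAt_le (by omega), hcoeff i hi]
    · rw [coeff_reverse, hdeg, revAt_eq_self_of_lt (by omega),
        coeff_eq_zero_of_natDegree_lt (by omega), ha, monicSum_twist_eq_zero hψ hd hcop hi]
  have hS : ∀ m : ℕ, (m : ℂ) * a m = ∑ r ∈ Finset.Icc 1 m,
      traceSum (GaloisField p r) ψ f * a (m - r) := by
    intro m
    rw [ha, mul_monicSum_eq twist_one twist_mul m]
    refine Finset.sum_congr rfl fun r hr => ?_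
    obtain ⟨h1, h2⟩ := Finset.mem_Icc.mp hr
    rw [traceSum_eq_sum_monicIrreds h0 (by omega) h2]
  -- Newton's identities for `h` and the logarithmic derivative `hS` are the same recursion up to
  -- sign.
  have hpow : ∀ r ≠ 0, powSum h r = -traceSum (GaloisField p r) ψ f := by
    intro r
    induction r using Nat.strong_induction_on with
    | _ r ih =>
      intro hr
      obtain ⟨q, rfl⟩ := Nat.exists_eq_succ_of_ne_zero hr
      have h1 := hS (q + 1)
      rw [Finset.sum_Icc_succ_top (by omega), Nat.sub_self, ha0, mul_one] at h1
      have h2 : ∑ i ∈ Finset.range (q + 1), powSum h i * h.reverse.coeff (q + 1 - i)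
          = -∑ r ∈ Finset.Icc 1 q, traceSum (GaloisField p r) ψ f * a (q + 1 - r) := by
        rw [← Finset.sum_neg_distrib]
        symm
        refine (Finset.sum_congr rfl fun i hi => ?_).trans
          (Finset.sum_subset (s₁ := Finset.Icc 1 q) ?_ ?_)
        · obtain ⟨hi1, hi2⟩ := Finset.mem_Icc.mp hi
          rw [ih i (by omega) (by omega), hrev, neg_mul]
        · intro i hi
          simp only [Finset.mem_Icc, Finset.mem_range] at hi ⊢
          omega
        · intro i hi hi'
          simp only [Finset.mem_Icc, Finset.mem_range] at hi hi'
          obtain rfl : i = 0 := by omega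
          rw [powSum_zero, zero_mul]
      rw [powSum_rec hmon, h2, hrev, h1]
      ring
  refine ⟨h.roots, ?_, fun r hr => ?_⟩
  · rw [← hdeg]; exact (IsAlgClosed.splits h).natDegree_eq_card_roots.symm
  · rw [← powSum_eq_sum_roots hmon (IsAlgClosed.splits h) hr, hpow r hr, neg_neg]

end LFunction

/-! ### Weil's bound -/

section Weil

variable {p : ℕ} [Fact p.Prime] {ψ : AddChar (ZMod p) ℂ} {f : (ZMod p)[X]}

theorem traceSum_galoisField_one :
    traceSum (GaloisField p 1) ψ f = ∑ x : ZMod p, ψ (f.eval x) := by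
  have := Fintype.ofFinite (GaloisField p 1)
  have hfr := GaloisField.finrank p (n := 1) one_ne_zero
  rw [traceSum, finsum_eq_sum_of_fintype]
  symm
  refine Fintype.sum_equiv (GaloisField.equivZmodP p).symm.toEquiv _ _ fun x => ?_
  have : (GaloisField.equivZmodP p).symm.toEquiv x = algebraMap (ZMod p) (GaloisField p 1) x :=
    (GaloisField.equivZmodP p).symm.commutes x
  rw [this, aeval_algebraMap_apply, Algebra.trace_algebraMap, hfr, one_smul]
  simp

/-- **Weil's bound** for exponential sums of a polynomial over a prime field. -/
theorem norm_sum_addChar_eval_le (hψ : ψ ≠ 1) (h0 : f.coeff 0 = 0) (hd : 0 < f.natDegree)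
    (hcop : p.Coprime f.natDegree) :
    ‖∑ x : ZMod p, ψ (f.eval x)‖ ≤ (f.natDegree - 1 : ℕ) * √p := by
  obtain ⟨s, hs, hpow⟩ := exists_traceSum_eq_powSum hψ h0 hd hcop
  obtain ⟨C, hC⟩ := exists_norm_traceSum_le hψ hd hcop
  have hp : (0 : ℝ) < p := by exact_mod_cast (Fact.out : p.Prime).pos
  have hbound : ∀ z ∈ s, ‖z‖ ≤ √p := by
    intro z hz
    -- Cancellation is known only over extensions of even degree, so the growth criterion is applied
    -- to the squares of the roots.
    have h : ‖z ^ 2‖ ≤ p := by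
      refine norm_le_of_norm_powSum_le (s := s.map fun z => z ^ 2) (C := C) hp (fun n hn => ?_)
        (Multiset.mem_map_of_mem _ hz)
      have := hC n hn
      rw [hpow (2 * n) (by omega), norm_neg] at this
      rw [Multiset.map_map]
      simpa [pow_mul] using this
    rw [norm_pow] at h
    exact Real.le_sqrt_of_sq_le h
  rw [← traceSum_galoisField_one, hpow 1 one_ne_zero, norm_neg, ← hs]
  simp only [pow_one, Multiset.map_id']
  have h1 := Multiset.sum_le_card_nsmul (s.map fun z => ‖z‖) (√p) (by
    intro y hy
    obtain ⟨z, hz, rfl⟩ := Multiset.mem_map.mp hy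
    exact hbound z hz)
  rw [Multiset.card_map, nsmul_eq_mul] at h1
  exact (norm_multiset_sum_le s).trans h1

end Weil

end CharacterSums

/-! ### Incomplete sums of additive characters -/

section IntervalSums

/-- The size `p / (2 |t|)` of an incomplete sum of an additive character at frequency `t`,
where `|t|` is the absolute value of the least residue. -/
noncomputable def freqBound {p : ℕ} (t : ZMod p) : ℝ := p / (2 * |(t.valMinAbs : ℝ)|)

theorem freqBound_nonneg {p : ℕ} (t : ZMod p) : 0 ≤ freqBound t := by unfold freqBound; positivity

variable {p : ℕ} [Fact p.Prime]

theorem abs_valMinAbs_pos {t : ZMod p} (ht : t ≠ 0) : 0 < |(t.valMinAbs : ℝ)| := by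
  rw [abs_pos, Int.cast_ne_zero, Ne, ZMod.valMinAbs_eq_zero]
  exact ht

/-- The left side is a lower bound for `2 |sin(πv/p)|` by Jordan's inequality, available because the
least residue has `|v| ≤ p / 2`. -/
theorem le_norm_stdAddChar_sub_one (t : ZMod p) :
    4 * |(t.valMinAbs : ℝ)| / p ≤ ‖ZMod.stdAddChar t - 1‖ := by
  have hp : (0 : ℝ) < p := by exact_mod_cast (Fact.out : p.Prime).pos
  set v := t.valMinAbs with hv
  have ht : t = ((v : ℤ) : ZMod p) := (ZMod.coe_valMinAbs t).symm
  have hexp : ZMod.stdAddChar t = Complex.exp (Complex.I * ((2 * Real.pi * v / p : ℝ) : ℂ)) := by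
    rw [ht, ZMod.stdAddChar_coe]
    congr 1
    push_cast
    ring
  have hle : |(v : ℝ)| ≤ p / 2 := by
    have h1 : v.natAbs ≤ p / 2 := ZMod.natAbs_valMinAbs_le t
    have h2 : (v.natAbs : ℝ) ≤ ((p / 2 : ℕ) : ℝ) := by exact_mod_cast h1
    rw [Nat.cast_natAbs, Int.cast_abs] at h2
    exact h2.trans Nat.cast_div_le
  rw [hexp, Complex.norm_exp_I_mul_ofReal_sub_one, norm_mul, Real.norm_eq_abs, Real.norm_eq_abs,
    abs_two]
  have habs : |2 * Real.pi * v / p / 2| = Real.pi * |(v : ℝ)| / p := by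
    rw [show 2 * Real.pi * v / p / 2 = Real.pi * v / p by ring, abs_div, abs_mul,
      abs_of_pos Real.pi_pos, abs_of_pos hp]
  have h := Real.mul_abs_le_abs_sin (x := 2 * Real.pi * v / p / 2) (by
    rw [habs, div_le_div_iff₀ hp (by norm_num)]
    nlinarith [Real.pi_pos])
  rw [habs] at h
  calc _ = 2 * (2 / Real.pi * (Real.pi * |(v : ℝ)| / p)) := by
        field_simp [Real.pi_ne_zero]; ring
    _ ≤ _ := by gcongr

theorem norm_sum_Icc_stdAddChar_le {t : ZMod p} (ht : t ≠ 0) (a b : ℤ) :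
    ‖∑ x ∈ Finset.Icc a b, ZMod.stdAddChar (t * (x : ZMod p))‖ ≤ freqBound t := by
  have hp : (0 : ℝ) < p := by exact_mod_cast (Fact.out : p.Prime).pos
  have hv := abs_valMinAbs_pos ht
  have hlow := le_norm_stdAddChar_sub_one t
  set ζ := ZMod.stdAddChar t with hζ
  have hpos : 0 < 4 * |(t.valMinAbs : ℝ)| / p := by positivity
  have hne : ζ ≠ 1 := by
    intro h
    rw [h, sub_self, norm_zero] at hlow
    linarith
  have hsum : ∑ x ∈ Finset.Icc a b, ZMod.stdAddChar (t * (x : ZMod p))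
      = ZMod.stdAddChar (t * (a : ZMod p)) * ∑ i ∈ Finset.range (b + 1 - a).toNat, ζ ^ i := by
    rw [Finset.mul_sum, Int.Icc_eq_finset_map, Finset.sum_map]
    refine Finset.sum_congr rfl fun i _ => ?_
    rw [hζ, ← AddChar.map_nsmul_eq_pow, ← AddChar.map_add_eq_mul]
    congr 1
    simp
    ring
  rw [hsum, norm_mul, AddChar.norm_apply, one_mul, geom_sum_eq hne, norm_div]
  have hnum : ‖ζ ^ (b + 1 - a).toNat - 1‖ ≤ 2 := by
    refine (norm_sub_le _ _).trans ?_
    rw [norm_pow, hζ, AddChar.norm_apply]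
    norm_num
  calc _ ≤ 2 / (4 * |(t.valMinAbs : ℝ)| / p) := by gcongr
    _ = freqBound t := by rw [freqBound]; field_simp; ring

/-- The absolute least residue is one of the residues of `t` and `-t` in `[1, p - 1]`. Adding both
reciprocals reduces the sum over `t` to harmonic sums. -/
theorem freqBound_le (t : ZMod p) (ht : t ≠ 0) :
    freqBound t ≤ p / 2 * ((t.val : ℝ)⁻¹ + ((-t).val : ℝ)⁻¹) := by
  have : NeZero t := ⟨ht⟩
  have h1 : t.valMinAbs.natAbs = min t.val (p - t.val) := ZMod.valMinAbs_natAbs_eq_min t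
  have h2 : (-t).val = p - t.val := ZMod.val_neg_of_ne_zero t
  have h3 : |(t.valMinAbs : ℝ)| = (t.valMinAbs.natAbs : ℝ) := by
    rw [Nat.cast_natAbs, Int.cast_abs]
  have h4 : freqBound t = p / 2 * |(t.valMinAbs : ℝ)|⁻¹ := by
    rw [freqBound, div_mul_eq_div_div, div_eq_mul_inv (p / 2 : ℝ)]
  rw [h4, h3, h1, h2]
  gcongr
  rcases min_cases t.val (p - t.val) with ⟨h, -⟩ | ⟨h, -⟩
  · rw [h]; exact le_add_of_nonneg_right (by positivity)
  · rw [h]; exact le_add_of_nonneg_left (by positivity)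

theorem sum_freqBound_le (hp3 : 3 ≤ p) :
    ∑ t : ZMod p with t ≠ 0, freqBound t ≤ 2 * p * Real.log p := by
  have hp : (0 : ℝ) < p := by exact_mod_cast (Fact.out : p.Prime).pos
  have hlog : 1 ≤ Real.log p := by
    rw [Real.le_log_iff_exp_le hp]
    have : Real.exp 1 < 2.7182818286 := Real.exp_one_lt_d9
    have : (3 : ℝ) ≤ p := by exact_mod_cast hp3
    linarith
  have hH : ∑ t : ZMod p with t ≠ 0, ((t.val : ℝ))⁻¹ ≤ 1 + Real.log p := by
    have h1 : ∑ t : ZMod p with t ≠ 0, ((t.val : ℝ))⁻¹ ≤ ∑ k ∈ Finset.Icc 1 p, ((k : ℝ))⁻¹ := by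
      rw [← Finset.sum_image (g := ZMod.val) (f := fun k : ℕ => ((k : ℝ))⁻¹)]
      · refine Finset.sum_le_sum_of_subset_of_nonneg ?_ fun _ _ _ => by positivity
        intro k hk
        obtain ⟨t, ht, rfl⟩ := Finset.mem_image.mp hk
        have ht0 := (Finset.mem_filter.mp ht).2
        rw [Finset.mem_Icc]
        exact ⟨Nat.pos_of_ne_zero (by rwa [Ne, ZMod.val_eq_zero]), (ZMod.val_lt t).le⟩
      · intro a _ b _ h
        exact ZMod.val_injective p h
    refine h1.trans ?_
    have h2 := harmonic_le_one_add_log p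
    rw [harmonic_eq_sum_Icc] at h2
    push_cast at h2
    exact h2
  have hH' : ∑ t : ZMod p with t ≠ 0, (((-t).val : ℝ))⁻¹ ≤ 1 + Real.log p := by
    refine le_trans (le_of_eq ?_) hH
    refine Finset.sum_bij (fun t _ => -t) ?_ ?_ ?_ ?_
    · intro t ht; simpa using ht
    · intro t _ t' _ h; exact neg_injective h
    · intro t ht; exact ⟨-t, by simpa using ht, neg_neg t⟩
    · intro t _; rfl
  calc _ ≤ ∑ t : ZMod p with t ≠ 0, p / 2 * ((t.val : ℝ)⁻¹ + ((-t).val : ℝ)⁻¹) :=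
        Finset.sum_le_sum fun t ht => freqBound_le t (Finset.mem_filter.mp ht).2
    _ = p / 2 * (∑ t : ZMod p with t ≠ 0, ((t.val : ℝ))⁻¹
          + ∑ t : ZMod p with t ≠ 0, (((-t).val : ℝ))⁻¹) := by
        rw [← Finset.mul_sum, Finset.sum_add_distrib]
    _ ≤ p / 2 * ((1 + Real.log p) + (1 + Real.log p)) := by gcongr
    _ ≤ _ := by nlinarith

theorem sum_freqBound_mul_le (hp3 : 3 ≤ p) {g : ZMod p} (hg : g ≠ 0) :
    ∑ h : ZMod p with h ≠ 0, freqBound (h * g) ≤ 2 * p * Real.log p := by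
  refine le_trans (le_of_eq ?_) (sum_freqBound_le hp3)
  refine Finset.sum_bij (fun t _ => t * g) ?_ ?_ ?_ ?_
  · intro t ht; simpa [hg] using ht
  · intro t _ t' _ h; exact mul_right_cancel₀ hg h
  · intro t ht
    exact ⟨t / g, by simpa [hg] using ht, div_mul_cancel₀ t hg⟩
  · intro t _; rfl

end IntervalSums

/-! ### Counting coincidences by Fourier analysis -/

section FourierCount

/-- The left side is the diagonal part of the expanded product. For empty `s` it would be `t.card`
against `1`. -/
theorem sum_prod_le_prod_sum {ι κ : Type*} {s : Finset ι} (hs : s.Nonempty) (t : Finset κ)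
    {f : ι → κ → ℝ} (hf : ∀ i k, 0 ≤ f i k) :
    ∑ k ∈ t, ∏ i ∈ s, f i k ≤ ∏ i ∈ s, ∑ k ∈ t, f i k := by
  classical
  induction hs using Finset.Nonempty.cons_induction with
  | singleton a => simp
  | cons a s ha hs ih =>
    simp only [Finset.prod_cons]
    calc _ ≤ ∑ k ∈ t, f a k * ∏ i ∈ s, ∑ k ∈ t, f i k := by
          refine Finset.sum_le_sum fun k hk => ?_
          gcongr with i hi
          · exact hf _ _
          · exact fun i _ => hf _ _
          · exact Finset.single_le_sum (f := fun k => f i k) (fun k _ => hf i k) hk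
      _ = _ := by rw [Finset.sum_mul]

variable {p : ℕ} [Fact p.Prime]

theorem stdAddChar_orthogonality (b : ZMod p) :
    ∑ h : ZMod p, ZMod.stdAddChar (h * b) = if b = 0 then (p : ℂ) else 0 := by
  have := AddChar.sum_mulShift b (ZMod.isPrimitive_stdAddChar p)
  rw [this]
  split_ifs <;> simp

theorem mul_card_filter_eq_sum {γ : Type*} (D : Finset γ) (f : γ → ZMod p) (c : ZMod p) :
    (p : ℂ) * ((D.filter fun x => f x = c).card : ℂ)
      = ∑ h : ZMod p, (∑ x ∈ D, ZMod.stdAddChar (h * f x)) * ZMod.stdAddChar (-(h * c)) := by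
  simp only [Finset.sum_mul, ← AddChar.map_add_eq_mul]
  rw [Finset.sum_comm, Finset.card_filter, Nat.cast_sum, Finset.mul_sum]
  refine Finset.sum_congr rfl fun x _ => ?_
  have : ∀ h : ZMod p, h * f x + -(h * c) = h * (f x - c) := fun h => by ring
  simp only [this, stdAddChar_orthogonality, sub_eq_zero]
  split_ifs <;> simp

variable {U α β : Type*} (V : Finset U) (A : Finset α) (B : Finset β)
  (s t : U → ZMod p) (ξ : α → ZMod p) (η : β → ZMod p)

/-- The number of coincidences, through Fourier analysis modulo `p`. -/
theorem sq_mul_sum_card_eq_sum :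
    (p : ℂ) ^ 2 * ∑ u ∈ V, (((A.filter fun x => ξ x = s u).card : ℂ)
        * ((B.filter fun y => η y = t u).card : ℂ))
      = ∑ h : ZMod p, ∑ k : ZMod p, (∑ x ∈ A, ZMod.stdAddChar (h * ξ x))
        * (∑ y ∈ B, ZMod.stdAddChar (k * η y))
        * ∑ u ∈ V, ZMod.stdAddChar (-(h * s u + k * t u)) := by
  have h1 : ∀ u, (p : ℂ) ^ 2 * (((A.filter fun x => ξ x = s u).card : ℂ)
        * ((B.filter fun y => η y = t u).card : ℂ))
      = ∑ h : ZMod p, ∑ k : ZMod p, (∑ x ∈ A, ZMod.stdAddChar (h * ξ x))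
        * (∑ y ∈ B, ZMod.stdAddChar (k * η y)) * ZMod.stdAddChar (-(h * s u + k * t u)) := by
    intro u
    rw [sq, mul_mul_mul_comm, mul_card_filter_eq_sum, mul_card_filter_eq_sum,
      Finset.sum_mul_sum]
    refine Finset.sum_congr rfl fun h _ => Finset.sum_congr rfl fun k _ => ?_
    rw [neg_add, AddChar.map_add_eq_mul]
    ring
  rw [Finset.mul_sum, Finset.sum_congr rfl fun u _ => h1 u, Finset.sum_comm]
  refine Finset.sum_congr rfl fun h _ => ?_
  rw [Finset.sum_comm]
  exact Finset.sum_congr rfl fun k _ => (Finset.mul_sum _ _ _).symm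

/-- The frequency `(0, 0)` is the main term. The others have total weight `(|A| + D₁)(|B| + D₂) -
|A||B|` at most, where `|A|` and `|B|` are the box sums at frequency zero. -/
theorem abs_sq_mul_sum_card_sub_le {τ D₁ D₂ : ℝ} (hτ : 0 ≤ τ)
    (hT : ∀ h k : ZMod p, h ≠ 0 ∨ k ≠ 0 →
      ‖∑ u ∈ V, ZMod.stdAddChar (-(h * s u + k * t u))‖ ≤ τ)
    (hD₁ : ∑ h : ZMod p with h ≠ 0, ‖∑ x ∈ A, ZMod.stdAddChar (h * ξ x)‖ ≤ D₁)
    (hD₂ : ∑ h : ZMod p with h ≠ 0, ‖∑ x ∈ B, ZMod.stdAddChar (h * η x)‖ ≤ D₂) :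
    |(p : ℝ) ^ 2 * ∑ u ∈ V, (((A.filter fun x => ξ x = s u).card : ℝ)
        * ((B.filter fun y => η y = t u).card : ℝ)) - A.card * B.card * V.card|
      ≤ τ * (A.card * D₂ + B.card * D₁ + D₁ * D₂) := by
  set b₁ : ZMod p → ℂ := fun h => ∑ x ∈ A, ZMod.stdAddChar (h * ξ x) with hb₁
  set b₂ : ZMod p → ℂ := fun h => ∑ x ∈ B, ZMod.stdAddChar (h * η x) with hb₂
  set T : ZMod p → ZMod p → ℂ :=
    fun h k => ∑ u ∈ V, ZMod.stdAddChar (-(h * s u + k * t u)) with hTdef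
  have hb₁0 : b₁ 0 = A.card := by simp [hb₁]
  have hb₂0 : b₂ 0 = B.card := by simp [hb₂]
  have hT0 : T 0 0 = V.card := by simp [hTdef]
  have hsplit : ∀ b : ZMod p → ℂ, ∑ h, ‖b h‖ = ‖b 0‖ + ∑ h with h ≠ 0, ‖b h‖ := by
    intro b
    rw [← Finset.sum_filter_add_sum_filter_not Finset.univ (fun h : ZMod p => h = 0)]
    congr 1
    rw [Finset.filter_eq' Finset.univ (0 : ZMod p), if_pos (Finset.mem_univ _),
      Finset.sum_singleton]
  have hmain := sq_mul_sum_card_eq_sum V A B s t ξ η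
  have hprod : ∑ h : ZMod p, ∑ k : ZMod p, b₁ h * b₂ k * T h k
      = ∑ q : ZMod p × ZMod p, b₁ q.1 * b₂ q.2 * T q.1 q.2 :=
    (Fintype.sum_prod_type' fun h k => b₁ h * b₂ k * T h k).symm
  have hprod' : ∑ q : ZMod p × ZMod p, ‖b₁ q.1‖ * ‖b₂ q.2‖
      = (∑ h, ‖b₁ h‖) * ∑ k, ‖b₂ k‖ := by
    rw [Fintype.sum_prod_type' fun h k => ‖b₁ h‖ * ‖b₂ k‖, Finset.sum_mul_sum]
  have hnorm : ‖∑ q : ZMod p × ZMod p, b₁ q.1 * b₂ q.2 * T q.1 q.2 - b₁ 0 * b₂ 0 * T 0 0‖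
      ≤ τ * ((∑ h, ‖b₁ h‖) * (∑ k, ‖b₂ k‖) - ‖b₁ 0‖ * ‖b₂ 0‖) := by
    rw [← hprod', ← Finset.add_sum_erase Finset.univ
      (fun q : ZMod p × ZMod p => b₁ q.1 * b₂ q.2 * T q.1 q.2) (Finset.mem_univ (0, 0)),
      ← Finset.add_sum_erase Finset.univ
      (fun q : ZMod p × ZMod p => ‖b₁ q.1‖ * ‖b₂ q.2‖) (Finset.mem_univ (0, 0)),
      add_sub_cancel_left, add_sub_cancel_left, Finset.mul_sum]
    refine (norm_sum_le _ _).trans (Finset.sum_le_sum fun q hq => ?_)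
    rw [norm_mul, norm_mul, mul_comm τ]
    gcongr
    apply hT
    by_contra! h
    exact Finset.ne_of_mem_erase hq (Prod.ext h.1 h.2)
  rw [← hprod, ← hmain, hsplit b₁, hsplit b₂, hb₁0, hb₂0, hT0] at hnorm
  simp only [Complex.norm_natCast] at hnorm
  have hD₁0 : 0 ≤ ∑ h with h ≠ 0, ‖b₁ h‖ := Finset.sum_nonneg fun _ _ => norm_nonneg _
  have hD₂0 : 0 ≤ ∑ h with h ≠ 0, ‖b₂ h‖ := Finset.sum_nonneg fun _ _ => norm_nonneg _
  have hcast : (p : ℂ) ^ 2 * ∑ u ∈ V, (((A.filter fun x => ξ x = s u).card : ℂ)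
        * ((B.filter fun y => η y = t u).card : ℂ)) - A.card * B.card * V.card
      = (((p : ℝ) ^ 2 * ∑ u ∈ V, (((A.filter fun x => ξ x = s u).card : ℝ)
        * ((B.filter fun y => η y = t u).card : ℝ)) - A.card * B.card * V.card : ℝ) : ℂ) := by
    push_cast; rfl
  rw [hcast, Complex.norm_real, Real.norm_eq_abs] at hnorm
  refine hnorm.trans ?_
  gcongr
  have hA : (0 : ℝ) ≤ A.card := Nat.cast_nonneg _
  have hB : (0 : ℝ) ≤ B.card := Nat.cast_nonneg _
  have e1 := mul_le_mul_of_nonneg_left hD₂ hA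
  have e2 := mul_le_mul_of_nonneg_left hD₁ hB
  have e3 := mul_le_mul hD₁ hD₂ hD₂0 (hD₁0.trans hD₁)
  nlinarith

end FourierCount

/-! ### Character sums over boxes -/

section BoxSums

theorem addChar_map_sum {A M ι : Type*} [AddCommMonoid A] [CommMonoid M] (ψ : AddChar A M)
    (s : Finset ι) (f : ι → A) : ψ (∑ i ∈ s, f i) = ∏ i ∈ s, ψ (f i) := by
  classical
  induction s using Finset.induction_on with
  | empty => simp
  | insert a s ha ih =>
    rw [Finset.sum_insert ha, Finset.prod_insert ha, AddChar.map_add_eq_mul, ih]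

variable {p : ℕ} [Fact p.Prime] {n : ℕ}

/-- The integer vectors `x` with `a - b ≤ x ≤ a + b`. -/
noncomputable def latticeBox (a b : Fin n → ℤ) : Finset (Fin n → ℤ) :=
  Fintype.piFinset fun j => Finset.Icc (a j - b j) (a j + b j)

theorem norm_sum_latticeBox_le {g : Fin n → ZMod p} (hg : ∀ j, g j ≠ 0) {h : ZMod p} (hh : h ≠ 0)
    (a b : Fin n → ℤ) :
    ‖∑ x ∈ latticeBox a b, ZMod.stdAddChar (h * ∑ j, (x j : ZMod p) * g j)‖
      ≤ ∏ j, freqBound (h * g j) := by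
  have : ∀ x : Fin n → ℤ, ZMod.stdAddChar (h * ∑ j, (x j : ZMod p) * g j)
      = ∏ j, ZMod.stdAddChar (h * g j * (x j : ZMod p)) := by
    intro x
    rw [Finset.mul_sum, addChar_map_sum]
    refine Finset.prod_congr rfl fun j _ => ?_
    congr 1; ring
  simp only [this]
  rw [latticeBox, ← Finset.prod_univ_sum (fun j => Finset.Icc (a j - b j) (a j + b j))
    (fun j x => ZMod.stdAddChar (h * g j * (x : ZMod p))), norm_prod]
  refine Finset.prod_le_prod (fun _ _ => norm_nonneg _) fun j _ => ?_
  exact norm_sum_Icc_stdAddChar_le (mul_ne_zero hh (hg j)) _ _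

theorem sum_norm_latticeBox_le (hp3 : 3 ≤ p) [NeZero n] {g : Fin n → ZMod p}
    (hg : ∀ j, g j ≠ 0) (a b : Fin n → ℤ) :
    ∑ h : ZMod p with h ≠ 0,
        ‖∑ x ∈ latticeBox a b, ZMod.stdAddChar (h * ∑ j, (x j : ZMod p) * g j)‖
      ≤ (2 * p * Real.log p) ^ n := by
  calc _ ≤ ∑ h : ZMod p with h ≠ 0, ∏ j, freqBound (h * g j) :=
        Finset.sum_le_sum fun h hh => norm_sum_latticeBox_le hg (Finset.mem_filter.mp hh).2 a b
    _ ≤ ∏ j, ∑ h : ZMod p with h ≠ 0, freqBound (h * g j) :=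
        sum_prod_le_prod_sum Finset.univ_nonempty _ fun _ _ => freqBound_nonneg _
    _ ≤ ∏ _j : Fin n, 2 * p * Real.log p :=
        Finset.prod_le_prod (fun j _ => Finset.sum_nonneg fun _ _ => freqBound_nonneg _)
          fun j _ => sum_freqBound_mul_le hp3 (hg j)
    _ = _ := by simp

/-- The saving when no multiple of `g` has all its least residues smaller than `p / (2 M)`. -/
theorem sum_norm_latticeBox_le_of_freqBound_le (hp3 : 3 ≤ p) (hn : 2 ≤ n) {g : Fin n → ZMod p}
    (hg : ∀ j, g j ≠ 0) {M : ℝ} (hM : ∀ h : ZMod p, h ≠ 0 → ∃ j, freqBound (h * g j) ≤ M)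
    (a b : Fin n → ℤ) :
    ∑ h : ZMod p with h ≠ 0,
        ‖∑ x ∈ latticeBox a b, ZMod.stdAddChar (h * ∑ j, (x j : ZMod p) * g j)‖
      ≤ n * (M * (2 * p * Real.log p) ^ (n - 1)) := by
  classical
  have hM0 : 0 ≤ M := by
    obtain ⟨j, hj⟩ := hM 1 one_ne_zero
    exact (freqBound_nonneg _).trans hj
  have hne : ∀ i : Fin n, (Finset.univ.erase i).Nonempty := by
    intro i
    rw [← Finset.card_pos, Finset.card_erase_of_mem (Finset.mem_univ i), Finset.card_univ,
      Fintype.card_fin]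
    omega
  -- The coordinate whose factor is at most `M` depends on `h`, so one sums over all choices of it,
  -- which costs the factor `n`.
  calc _ ≤ ∑ h : ZMod p with h ≠ 0, ∑ i, M * ∏ j ∈ Finset.univ.erase i, freqBound (h * g j) := by
        refine Finset.sum_le_sum fun h hh => ?_
        have hh0 := (Finset.mem_filter.mp hh).2
        refine (norm_sum_latticeBox_le hg hh0 a b).trans ?_
        obtain ⟨i, hi⟩ := hM h hh0
        have hnn : ∀ i : Fin n, 0 ≤ ∏ j ∈ Finset.univ.erase i, freqBound (h * g j) :=
          fun i => Finset.prod_nonneg fun _ _ => freqBound_nonneg _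
        rw [← Finset.mul_prod_erase Finset.univ _ (Finset.mem_univ i)]
        refine (mul_le_mul_of_nonneg_right hi (hnn i)).trans ?_
        exact Finset.single_le_sum (f := fun i => M * ∏ j ∈ Finset.univ.erase i, freqBound (h * g j))
          (fun i _ => mul_nonneg hM0 (hnn i)) (Finset.mem_univ i)
    _ = ∑ i, M * ∑ h : ZMod p with h ≠ 0, ∏ j ∈ Finset.univ.erase i, freqBound (h * g j) := by
        rw [Finset.sum_comm]
        simp only [Finset.mul_sum]
    _ ≤ ∑ _i : Fin n, M * (2 * p * Real.log p) ^ (n - 1) := by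
        refine Finset.sum_le_sum fun i _ => ?_
        gcongr
        refine (sum_prod_le_prod_sum (hne i) _ fun _ _ => freqBound_nonneg _).trans ?_
        refine (Finset.prod_le_prod (fun j _ => Finset.sum_nonneg fun _ _ => freqBound_nonneg _)
          fun j _ => sum_freqBound_mul_le hp3 (hg j)).trans_eq ?_
        rw [Finset.prod_const, Finset.card_erase_of_mem (Finset.mem_univ i), Finset.card_univ,
          Fintype.card_fin]
    _ = _ := by simp

theorem card_latticeBox {a b : Fin n → ℤ} (hb : ∀ j, 0 < b j) :
    ((latticeBox a b).card : ℝ) = ∏ j, (2 * (b j : ℝ) + 1) := by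
  rw [latticeBox, Fintype.card_piFinset, Nat.cast_prod]
  refine Finset.prod_congr rfl fun j _ => ?_
  rw [Int.card_Icc]
  have : (0 : ℤ) ≤ a j + b j + 1 - (a j - b j) := by have := hb j; omega
  rw [← Int.cast_natCast, Int.toNat_of_nonneg this]
  push_cast; ring

end BoxSums

/-! ### Multiples of the reduced basis vector are not short -/

section ShortVectors

variable {K : Type*} [Field K] [NumberField K]

/-- The ideal `(x)` contains the nonzero integer `N = absNorm (x)`, and `φ(N z) = N φ(z)`. -/
theorem linearMap_eq_zero_of_mul_eq_zero {φ : 𝓞 K →ₗ[ℤ] ℤ} {x : 𝓞 K} (hx : x ≠ 0)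
    (h : ∀ y, φ (x * y) = 0) : φ = 0 := by
  have hN0 : Ideal.absNorm (Ideal.span {x}) ≠ 0 := by
    rw [Ne, Ideal.absNorm_eq_zero_iff, Ideal.span_singleton_eq_bot]
    exact hx
  obtain ⟨y, hy⟩ := Ideal.mem_span_singleton'.mp (Ideal.absNorm_mem (Ideal.span {x}))
  ext z
  have h1 := h (y * z)
  have h2 : x * (y * z) = (Ideal.absNorm (Ideal.span {x}) : ℤ) • z := by
    rw [zsmul_eq_mul, Int.cast_natCast, ← hy]; ring
  rw [h2, map_smul, smul_eq_mul] at h1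
  rw [LinearMap.zero_apply]
  exact (mul_eq_zero.mp h1).resolve_left (by exact_mod_cast hN0)

/-- For a nonzero functional `φ` the matrix `φ (γᵢ γⱼ)` has rank at least two when `γ` does. -/
theorem exists_minor_ne_zero {ι : Type*} (γ : Module.Basis ι ℤ (𝓞 K)) {φ : 𝓞 K →ₗ[ℤ] ℤ}
    (hφ : φ ≠ 0) {i j : ι} (hij : i ≠ j) :
    ∃ k l, φ (γ i * γ k) * φ (γ j * γ l) - φ (γ i * γ l) * φ (γ j * γ k) ≠ 0 := by
  by_contra! h
  have hlin : ∀ x y, φ (γ i * x) * φ (γ j * y) = φ (γ i * y) * φ (γ j * x) := by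
    let L : 𝓞 K → 𝓞 K →ₗ[ℤ] ℤ := fun a => φ.comp (LinearMap.mulLeft ℤ a)
    have hL : (LinearMap.mul ℤ ℤ).compl₁₂ (L (γ i)) (L (γ j))
        = ((LinearMap.mul ℤ ℤ).compl₁₂ (L (γ i)) (L (γ j))).flip := by
      refine γ.ext fun k => γ.ext fun l => ?_
      simpa [L, sub_eq_zero] using h k l
    intro x y
    have := congrArg (fun B : 𝓞 K →ₗ[ℤ] 𝓞 K →ₗ[ℤ] ℤ => B x y) hL
    simpa [L] using this
  obtain ⟨y, hy⟩ : ∃ y, φ (γ j * y) ≠ 0 := by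
    by_contra! h'
    exact hφ (linearMap_eq_zero_of_mul_eq_zero (γ.ne_zero j) h')
  -- By `hlin`, `φ` vanishes on every multiple of this element, so the element is zero, against the
  -- independence of `γ i` and `γ j`.
  have hz : φ (γ j * y) • γ i - φ (γ i * y) • γ j = 0 := by
    by_contra hne
    refine hφ (linearMap_eq_zero_of_mul_eq_zero hne fun x => ?_)
    rw [sub_mul, map_sub, smul_mul_assoc, smul_mul_assoc, map_smul, map_smul, smul_eq_mul,
      smul_eq_mul, ← hlin x y]
    ring
  have := congrArg (fun z => γ.repr z i) hz
  simp only [map_sub, map_smul, Module.Basis.repr_self, Finsupp.sub_apply, Finsupp.smul_apply,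
    Finsupp.single_eq_same, Finsupp.single_eq_of_ne hij, mul_zero, sub_zero, smul_eq_mul,
    mul_one, map_zero, Finsupp.zero_apply] at this
  exact hy this

theorem abs_mul_sub_mul_le {a b c d B : ℝ} (ha : |a| ≤ B) (hb : |b| ≤ B) (hc : |c| ≤ B)
    (hd : |d| ≤ B) : |a * b - c * d| ≤ 2 * B ^ 2 := by
  have hB : 0 ≤ B := (abs_nonneg a).trans ha
  refine (abs_sub _ _).trans ?_
  rw [abs_mul, abs_mul]
  have h1 := mul_le_mul ha hb (abs_nonneg b) hB
  have h2 := mul_le_mul hc hd (abs_nonneg d) hB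
  linarith

/-- A nonzero functional proportional to a residue map modulo `p` has a value of size at least
`√(p / 2)` on the products of basis elements. -/
theorem le_two_mul_sq_of_abs_le {n : ℕ} (hn : 2 ≤ n) (γ : Module.Basis (Fin n) ℤ (𝓞 K)) {p : ℕ}
    {ρ : 𝓞 K →+* ZMod p} {h : ZMod p} {φ : 𝓞 K →ₗ[ℤ] ℤ} (hφ0 : φ ≠ 0)
    (hφρ : ∀ x, ((φ x : ℤ) : ZMod p) = h * ρ x) {B : ℝ}
    (hB : ∀ i j, |(φ (γ i * γ j) : ℝ)| ≤ B) : (p : ℝ) ≤ 2 * B ^ 2 := by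
  obtain ⟨k, l, hkl⟩ := exists_minor_ne_zero γ hφ0
    (i := ⟨0, by omega⟩) (j := ⟨1, by omega⟩) (by simp)
  generalize (⟨0, by omega⟩ : Fin n) = i₀ at hkl
  generalize (⟨1, by omega⟩ : Fin n) = i₁ at hkl
  -- Modulo `p` the matrix is `h * ρ(γᵢ) * ρ(γⱼ)`, of rank one, so every minor is divisible by `p`;
  -- a nonzero one has size at least `p`.
  have hdvd : (p : ℤ) ∣ φ (γ i₀ * γ k) * φ (γ i₁ * γ l) - φ (γ i₀ * γ l) * φ (γ i₁ * γ k) := by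
    rw [← ZMod.intCast_zmod_eq_zero_iff_dvd, Int.cast_sub, Int.cast_mul, Int.cast_mul]
    simp only [hφρ, map_mul]
    ring
  have hle := Int.le_of_dvd (abs_pos.mpr hkl) ((dvd_abs _ _).mpr hdvd)
  have hle' : (p : ℝ) ≤ |(φ (γ i₀ * γ k) : ℝ) * (φ (γ i₁ * γ l) : ℝ)
      - (φ (γ i₀ * γ l) : ℝ) * (φ (γ i₁ * γ k) : ℝ)| := by exact_mod_cast hle
  exact hle'.trans (abs_mul_sub_mul_le (hB _ _) (hB _ _) (hB _ _) (hB _ _))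

/-- The multiples of the vector `(γⱼ mod P)` have no short representatives. -/
theorem exists_freqBound_le {n : ℕ} (hn : 2 ≤ n) (γ : Module.Basis (Fin n) ℤ (𝓞 K)) :
    ∃ κ : ℝ, 0 ≤ κ ∧ ∀ (p : ℕ) [Fact p.Prime] (ρ : 𝓞 K →+* ZMod p), (∀ j, ρ (γ j) ≠ 0) →
      ∀ h : ZMod p, h ≠ 0 → ∃ j, freqBound (h * ρ (γ j)) ≤ κ * √p := by
  set S : ℝ := ∑ i, ∑ j, ∑ l, |(γ.repr (γ i * γ j) l : ℝ)| with hS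
  have hS0 : 0 ≤ S := by positivity
  refine ⟨S, hS0, fun p _ ρ hρ h hh => ?_⟩
  have : NeZero n := ⟨by omega⟩
  have hp : (0 : ℝ) < p := by exact_mod_cast (Fact.out : p.Prime).pos
  set r : Fin n → ℤ := fun j => (h * ρ (γ j)).valMinAbs with hr
  have hrcast : ∀ j, ((r j : ℤ) : ZMod p) = h * ρ (γ j) := fun j => ZMod.coe_valMinAbs _
  have hr0 : ∀ j, r j ≠ 0 := by
    intro j
    rw [hr, Ne, ZMod.valMinAbs_eq_zero]
    exact mul_ne_zero hh (hρ j)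
  obtain ⟨m, -, hm⟩ := Finset.univ.exists_max_image (fun j => |(r j : ℝ)|) Finset.univ_nonempty
  set R := |(r m : ℝ)| with hR
  have hR0 : 0 < R := abs_pos.mpr (by exact_mod_cast hr0 m)
  refine ⟨m, ?_⟩
  let φ : 𝓞 K →ₗ[ℤ] ℤ := γ.constr ℤ r
  have hφ_apply : ∀ x, φ x = ∑ j, γ.repr x j * r j := by
    intro x
    simp [φ, Module.Basis.constr_apply_fintype]
  have hφ0 : φ ≠ 0 := by
    intro h0
    have : φ (γ m) = r m := γ.constr_basis ℤ r m
    rw [h0] at this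
    exact hr0 m this.symm
  have hφρ : ∀ x, ((φ x : ℤ) : ZMod p) = h * ρ x := by
    intro x
    conv_rhs => rw [← γ.sum_repr x]
    rw [hφ_apply]
    push_cast
    simp only [hrcast, map_sum, zsmul_eq_mul, map_mul, map_intCast, Finset.mul_sum]
    refine Finset.sum_congr rfl fun j _ => by ring
  have hbound : ∀ i j, |(φ (γ i * γ j) : ℝ)| ≤ S * R := by
    intro i j
    rw [hφ_apply]
    push_cast
    calc _ ≤ ∑ l, |(γ.repr (γ i * γ j) l : ℝ) * (r l : ℝ)| := Finset.abs_sum_le_sum_abs _ _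
      _ ≤ ∑ l, |(γ.repr (γ i * γ j) l : ℝ)| * R := by
          refine Finset.sum_le_sum fun l _ => ?_
          rw [abs_mul]
          gcongr
          exact hm l (Finset.mem_univ l)
      _ = (∑ l, |(γ.repr (γ i * γ j) l : ℝ)|) * R := by rw [Finset.sum_mul]
      _ ≤ S * R := by
          gcongr
          calc _ ≤ ∑ j, ∑ l, |(γ.repr (γ i * γ j) l : ℝ)| :=
                Finset.single_le_sum (f := fun j => ∑ l, |(γ.repr (γ i * γ j) l : ℝ)|)
                  (fun _ _ => by positivity) (Finset.mem_univ j)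
            _ ≤ _ := Finset.single_le_sum
                  (f := fun i => ∑ j, ∑ l, |(γ.repr (γ i * γ j) l : ℝ)|)
                  (fun _ _ => by positivity) (Finset.mem_univ i)
  have hpB := le_two_mul_sq_of_abs_le hn γ hφ0 hφρ hbound
  have hsqrt : √p ≤ 2 * (S * R) := by
    rw [Real.sqrt_le_left (by positivity)]
    nlinarith only [sq_nonneg (S * R), hpB]
  rw [freqBound, div_le_iff₀ (by positivity)]
  calc (p : ℝ) = √p * √p := (Real.mul_self_sqrt hp.le).symm
    _ ≤ √p * (2 * (S * R)) := by gcongr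
    _ = _ := by rw [hR]; ring

end ShortVectors

/-! ### Isomorphisms and automorphisms of short models -/

section ShortModels

open CurveBox WeierstrassCurve

theorem shortModel_injective {R : Type*} [CommRing R] {a b a' b' : R}
    (h : shortModel a b = shortModel a' b') : a = a' ∧ b = b' :=
  ⟨congrArg WeierstrassCurve.a₄ h, congrArg WeierstrassCurve.a₆ h⟩

theorem shortModel_map {R S : Type*} [CommRing R] [CommRing S] (φ : R →+* S) (a b : R) :
    (shortModel a b).map φ = shortModel (φ a) (φ b) := by
  simp [shortModel, WeierstrassCurve.map]

variable {k : Type*} [Field k]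

/-- The vanishing of `a₁`, `a₂`, `a₃` in turn forces `s`, `r`, `t` to vanish after division by `2`,
`3`, `2`; only the scaling by `u` survives. -/
theorem smul_shortModel_eq_iff (h2 : (2 : k) ≠ 0) (h3 : (3 : k) ≠ 0) (C : VariableChange k)
    (α β a b : k) : C • shortModel α β = shortModel a b ↔
      (C.r = 0 ∧ C.s = 0 ∧ C.t = 0) ∧ α = (C.u : k) ^ 4 * a ∧ β = (C.u : k) ^ 6 * b := by
  have hu : (C.u : k) ≠ 0 := C.u.ne_zero
  constructor
  · intro h
    have e1 := congrArg WeierstrassCurve.a₁ h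
    have e2 := congrArg WeierstrassCurve.a₂ h
    have e3 := congrArg WeierstrassCurve.a₃ h
    have e4 := congrArg WeierstrassCurve.a₄ h
    have e6 := congrArg WeierstrassCurve.a₆ h
    simp only [variableChange_a₁, variableChange_a₂, variableChange_a₃, variableChange_a₄,
      variableChange_a₆, shortModel, Units.val_inv_eq_inv_val] at e1 e2 e3 e4 e6
    have hs : C.s = 0 := by simpa [hu, h2] using e1
    have hr : C.r = 0 := by simpa [hu, h3, hs] using e2
    have ht : C.t = 0 := by simpa [hu, h2, hr] using e3
    refine ⟨⟨hr, hs, ht⟩, ?_, ?_⟩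
    · rw [← e4]; simp [hr, hs, ht, hu]
    · rw [← e6]; simp [hr, ht, hu]
  · rintro ⟨⟨hr, hs, ht⟩, rfl, rfl⟩
    ext <;> simp [variableChange_a₁, variableChange_a₂, variableChange_a₃, variableChange_a₄,
      variableChange_a₆, shortModel, hr, hs, ht, hu]

theorem isomorphic_shortModel_iff (h2 : (2 : k) ≠ 0) (h3 : (3 : k) ≠ 0) (α β a b : k) :
    Isomorphic (shortModel α β) (shortModel a b) ↔
      ∃ u : kˣ, α = (u : k) ^ 4 * a ∧ β = (u : k) ^ 6 * b := by
  constructor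
  · rintro ⟨C, hC⟩
    exact ⟨C.u, ((smul_shortModel_eq_iff h2 h3 C α β a b).mp hC).2⟩
  · rintro ⟨u, hu⟩
    exact ⟨⟨u, 0, 0, 0⟩, (smul_shortModel_eq_iff h2 h3 _ α β a b).mpr ⟨⟨rfl, rfl, rfl⟩, hu⟩⟩

theorem autCount_shortModel (h2 : (2 : k) ≠ 0) (h3 : (3 : k) ≠ 0) (a b : k) :
    autCount (shortModel a b)
      = Nat.card {u : kˣ // a = (u : k) ^ 4 * a ∧ b = (u : k) ^ 6 * b} := by
  refine Nat.card_congr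
    { toFun := fun C => ⟨C.1.u, ((smul_shortModel_eq_iff h2 h3 C.1 a b a b).mp C.2).2⟩
      invFun := fun u => ⟨⟨u.1, 0, 0, 0⟩,
        (smul_shortModel_eq_iff h2 h3 _ a b a b).mpr ⟨⟨rfl, rfl, rfl⟩, u.2⟩⟩
      left_inv := ?_
      right_inv := fun u => rfl }
  rintro ⟨C, hC⟩
  obtain ⟨⟨hr, hs, ht⟩, -⟩ := (smul_shortModel_eq_iff h2 h3 C a b a b).mp hC
  apply Subtype.ext
  ext
  · rfl
  · exact hr.symm
  · exact hs.symm
  · exact ht.symm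

theorem eq_pow_mul_self_iff {a : k} (ha : a ≠ 0) (u : kˣ) (n : ℕ) :
    a = (u : k) ^ n * a ↔ u ^ n = 1 := by
  rw [eq_comm, mul_eq_right₀ ha, ← Units.val_pow_eq_pow_val, Units.val_eq_one]

/-- The unit group is cyclic of order `|k| - 1`. -/
theorem card_units_pow_eq_one [Finite k] (d : ℕ) :
    Nat.card {u : kˣ // u ^ d = 1} = (Nat.card k - 1).gcd d := by
  rw [← Nat.card_units k, ← IsCyclic.card_powMonoidHom_ker]
  rfl

theorem autCount_eq_two [Finite k] (h2 : (2 : k) ≠ 0) (h3 : (3 : k) ≠ 0) {a b : k}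
    (hab : a * b ≠ 0) : autCount (shortModel a b) = 2 := by
  have ha := left_ne_zero_of_mul hab
  have hb := right_ne_zero_of_mul hab
  rw [autCount_shortModel h2 h3]
  have hodd : (Nat.card k - 1).gcd 2 = 2 := by
    have := Fintype.ofFinite k
    have hchar : ringChar k ≠ 2 := by
      intro h
      have := ringChar.spec k 2
      rw [h] at this
      exact h2 (by exact_mod_cast this.mpr dvd_rfl)
    have h := FiniteField.odd_card_of_char_ne_two hchar
    rw [Nat.gcd_eq_right_iff_dvd, Nat.card_eq_fintype_card]
    omega
  rw [← hodd, ← card_units_pow_eq_one]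
  refine Nat.card_congr (Equiv.subtypeEquivRight fun u => ?_)
  rw [eq_pow_mul_self_iff ha, eq_pow_mul_self_iff hb]
  constructor
  · rintro ⟨h4, h6⟩
    have : u ^ 6 = u ^ 4 * u ^ 2 := by rw [← pow_add]
    rwa [h6, h4, one_mul, eq_comm] at this
  · intro h
    exact ⟨by rw [show 4 = 2 * 2 from rfl, pow_mul, h, one_pow],
      by rw [show 6 = 2 * 3 from rfl, pow_mul, h, one_pow]⟩

theorem autCount_eq_gcd_four [Finite k] (h2 : (2 : k) ≠ 0) (h3 : (3 : k) ≠ 0) {a b : k}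
    (ha : a ≠ 0) (hb : b = 0) : autCount (shortModel a b) = Nat.gcd 4 (Nat.card k - 1) := by
  subst hb
  rw [autCount_shortModel h2 h3, Nat.gcd_comm, ← card_units_pow_eq_one]
  exact Nat.card_congr (Equiv.subtypeEquivRight fun u => by
    rw [eq_pow_mul_self_iff ha]; simp)

theorem autCount_eq_gcd_six [Finite k] (h2 : (2 : k) ≠ 0) (h3 : (3 : k) ≠ 0) {a b : k}
    (ha : a = 0) (hb : b ≠ 0) : autCount (shortModel a b) = Nat.gcd 6 (Nat.card k - 1) := by
  subst ha
  rw [autCount_shortModel h2 h3, Nat.gcd_comm, ← card_units_pow_eq_one]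
  exact Nat.card_congr (Equiv.subtypeEquivRight fun u => by
    rw [eq_pow_mul_self_iff hb]; simp)

end ShortModels

/-! ### Reduction to counting box points on an orbit -/

section ModelCount

open CurveBox

variable {K : Type*} [Field K] [NumberField K]

/-- A nonempty fibre of the orbit map is a coset of the stabilizer. -/
theorem card_units_fiber_eq {k : Type*} [Field k] [Fintype kˣ] [DecidableEq k] {a b s t : k}
    (h : ∃ u : kˣ, s = (u : k) ^ 4 * a ∧ t = (u : k) ^ 6 * b) :
    (Finset.univ.filter fun u : kˣ => s = (u : k) ^ 4 * a ∧ t = (u : k) ^ 6 * b).card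
      = Nat.card {u : kˣ // a = (u : k) ^ 4 * a ∧ b = (u : k) ^ 6 * b} := by
  obtain ⟨v, rfl, rfl⟩ := h
  have hv : (v : k) ≠ 0 := v.ne_zero
  rw [Nat.card_eq_fintype_card, Fintype.card_subtype]
  refine (Finset.card_bij (fun u _ => v * u) ?_ ?_ ?_).symm
  · intro u hu
    simp only [Finset.mem_filter, Finset.mem_univ, true_and, Units.val_mul, mul_pow] at hu ⊢
    rw [mul_assoc, mul_assoc, ← hu.1, ← hu.2]
    exact ⟨rfl, rfl⟩
  · intro u _ u' _ h
    exact mul_left_cancel h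
  · intro u hu
    refine ⟨v⁻¹ * u, ?_, mul_inv_cancel_left v u⟩
    simp only [Finset.mem_filter, Finset.mem_univ, true_and, Units.val_mul, mul_pow,
      Units.val_inv_eq_inv_val] at hu ⊢
    rw [mul_assoc, mul_assoc, ← hu.1, ← hu.2]
    exact ⟨by field_simp, by field_simp⟩

theorem ncard_modelsReducingTo_eq (γ : Module.Basis (Fin (Module.finrank ℚ K)) ℤ (𝓞 K))
    (a₁ b₁ a₂ b₂ : Fin (Module.finrank ℚ K) → ℤ) (P : Ideal (𝓞 K)) [P.IsMaximal]
    (h2 : (2 : 𝓞 K ⧸ P) ≠ 0) (h3 : (3 : 𝓞 K ⧸ P) ≠ 0) {F : Type*} [Field F] [DecidableEq F]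
    [Fintype Fˣ] (e : 𝓞 K ⧸ P ≃+* F) (a b : 𝓞 K ⧸ P) :
    (modelsReducingTo γ a₁ b₁ a₂ b₂ P (shortModel a b)).ncard
      = ((latticeBox a₁ b₁ ×ˢ latticeBox a₂ b₂).filter fun q => ∃ u : Fˣ,
        ∑ j, (q.1 j : F) * e (Ideal.Quotient.mk P (γ j)) = (u : F) ^ 4 * e a ∧
        ∑ j, (q.2 j : F) * e (Ideal.Quotient.mk P (γ j)) = (u : F) ^ 6 * e b).card := by
  let := Ideal.Quotient.field P
  let σ : (Fin (Module.finrank ℚ K) → ℤ) → 𝓞 K := fun x => ∑ j, x j • γ j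
  have hσ : ∀ x j, γ.repr (σ x) j = x j := fun x j => by
    simp only [σ, γ.repr_sum_self]
  have hσ' : ∀ α, σ (fun j => γ.repr α j) = α := fun α => γ.sum_repr α
  have hred : ∀ x, e (Ideal.Quotient.mk P (σ x))
      = ∑ j, (x j : F) * e (Ideal.Quotient.mk P (γ j)) := by
    intro x
    simp only [σ, map_sum, zsmul_eq_mul, map_mul, map_intCast]
  have hiso : ∀ x y, Isomorphic ((shortModel (σ x) (σ y)).map (Ideal.Quotient.mk P))
      (shortModel a b) ↔ ∃ u : Fˣ,
        ∑ j, (x j : F) * e (Ideal.Quotient.mk P (γ j)) = (u : F) ^ 4 * e a ∧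
        ∑ j, (y j : F) * e (Ideal.Quotient.mk P (γ j)) = (u : F) ^ 6 * e b := by
    intro x y
    rw [shortModel_map, isomorphic_shortModel_iff h2 h3, ← hred, ← hred]
    constructor
    · rintro ⟨u, h4, h6⟩
      refine ⟨Units.map e.toRingHom.toMonoidHom u, ?_, ?_⟩
      · rw [h4]; simp
      · rw [h6]; simp
    · rintro ⟨u, h4, h6⟩
      refine ⟨Units.map e.symm.toRingHom.toMonoidHom u, ?_, ?_⟩
      · apply e.injective; rw [h4]; simp
      · apply e.injective; rw [h6]; simp
  have hbox : ∀ (c d : Fin (Module.finrank ℚ K) → ℤ) x, σ x ∈ intBox γ c d ↔ x ∈ latticeBox c d := by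
    intro c d x
    simp only [intBox, Set.mem_ofPred_eq, hσ, latticeBox, Fintype.mem_piFinset, Finset.mem_Icc]
  have himage : modelsReducingTo γ a₁ b₁ a₂ b₂ P (shortModel a b)
      = (fun q : (Fin (Module.finrank ℚ K) → ℤ) × (Fin (Module.finrank ℚ K) → ℤ) =>
          shortModel (σ q.1) (σ q.2)) ''
        (((latticeBox a₁ b₁ ×ˢ latticeBox a₂ b₂).filter fun q => ∃ u : Fˣ,
        ∑ j, (q.1 j : F) * e (Ideal.Quotient.mk P (γ j)) = (u : F) ^ 4 * e a ∧
        ∑ j, (q.2 j : F) * e (Ideal.Quotient.mk P (γ j)) = (u : F) ^ 6 * e b :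
          Finset ((Fin (Module.finrank ℚ K) → ℤ) × (Fin (Module.finrank ℚ K) → ℤ))) :
          Set ((Fin (Module.finrank ℚ K) → ℤ) × (Fin (Module.finrank ℚ K) → ℤ))) := by
    ext W
    simp only [modelsReducingTo, modelBox, Set.mem_ofPred_eq, Set.mem_image, Finset.mem_coe,
      Finset.mem_filter, Finset.mem_product]
    constructor
    · rintro ⟨⟨α, hα, β, hβ, rfl⟩, h⟩
      refine ⟨(fun j => γ.repr α j, fun j => γ.repr β j), ⟨⟨?_, ?_⟩, ?_⟩, ?_⟩
      · rw [← hbox, hσ']; exact hα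
      · rw [← hbox, hσ']; exact hβ
      · rw [← hiso, hσ', hσ']; exact h
      · simp only [hσ']
    · rintro ⟨⟨x, y⟩, ⟨⟨hx, hy⟩, h⟩, rfl⟩
      exact ⟨⟨σ x, (hbox _ _ _).mpr hx, σ y, (hbox _ _ _).mpr hy, rfl⟩, (hiso x y).mpr h⟩
  rw [himage, Set.ncard_image_of_injective, Set.ncard_coe_finset]
  rintro ⟨x, y⟩ ⟨x', y'⟩ h
  obtain ⟨h1, h1'⟩ := shortModel_injective h
  refine Prod.ext (funext fun j => ?_) (funext fun j => ?_)
  · exact (hσ x j).symm.trans ((congrArg (γ.repr · j) h1).trans (hσ x' j))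
  · exact (hσ y j).symm.trans ((congrArg (γ.repr · j) h1').trans (hσ y' j))

/-- Each model counted is hit by exactly `#Aut` units. Once `u` is fixed, the conditions on `α` and
`β` separate, which gives a product of two counts. -/
theorem autCount_mul_ncard_eq (γ : Module.Basis (Fin (Module.finrank ℚ K)) ℤ (𝓞 K))
    (a₁ b₁ a₂ b₂ : Fin (Module.finrank ℚ K) → ℤ) (P : Ideal (𝓞 K)) [P.IsMaximal]
    (h2 : (2 : 𝓞 K ⧸ P) ≠ 0) (h3 : (3 : 𝓞 K ⧸ P) ≠ 0) {F : Type*} [Field F] [DecidableEq F]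
    [Fintype Fˣ] (e : 𝓞 K ⧸ P ≃+* F) (a b : 𝓞 K ⧸ P) :
    autCount (shortModel a b) * (modelsReducingTo γ a₁ b₁ a₂ b₂ P (shortModel a b)).ncard
      = ∑ u : Fˣ, ((latticeBox a₁ b₁).filter fun x =>
          ∑ j, (x j : F) * e (Ideal.Quotient.mk P (γ j)) = (u : F) ^ 4 * e a).card
        * ((latticeBox a₂ b₂).filter fun y =>
          ∑ j, (y j : F) * e (Ideal.Quotient.mk P (γ j)) = (u : F) ^ 6 * e b).card := by
  let := Ideal.Quotient.field P
  have haut : autCount (shortModel a b)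
      = Nat.card {u : Fˣ // e a = (u : F) ^ 4 * e a ∧ e b = (u : F) ^ 6 * e b} := by
    rw [autCount_shortModel h2 h3]
    refine Nat.card_congr ((Units.mapEquiv e.toMulEquiv).toEquiv.subtypeEquiv fun u => ?_)
    rw [← e.injective.eq_iff, ← e.injective.eq_iff (a := b)]
    simp
  rw [ncard_modelsReducingTo_eq γ a₁ b₁ a₂ b₂ P h2 h3 e, Finset.card_filter, Finset.mul_sum, haut]
  have hrhs : ∀ u : Fˣ, ((latticeBox a₁ b₁).filter fun x =>
          ∑ j, (x j : F) * e (Ideal.Quotient.mk P (γ j)) = (u : F) ^ 4 * e a).card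
        * ((latticeBox a₂ b₂).filter fun y =>
          ∑ j, (y j : F) * e (Ideal.Quotient.mk P (γ j)) = (u : F) ^ 6 * e b).card
      = ∑ q ∈ latticeBox a₁ b₁ ×ˢ latticeBox a₂ b₂,
        if ∑ j, (q.1 j : F) * e (Ideal.Quotient.mk P (γ j)) = (u : F) ^ 4 * e a ∧
          ∑ j, (q.2 j : F) * e (Ideal.Quotient.mk P (γ j)) = (u : F) ^ 6 * e b then 1 else 0 := by
    intro u
    rw [← Finset.card_product, ← Finset.filter_product, Finset.card_filter]
  simp only [hrhs]
  rw [Finset.sum_comm]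
  refine Finset.sum_congr rfl fun q _ => ?_
  rw [← Finset.card_filter]
  split_ifs with h
  · rw [card_units_fiber_eq h, mul_one]
  · rw [mul_zero, eq_comm, Finset.card_eq_zero, Finset.filter_eq_empty_iff]
    exact fun u _ hu => h ⟨u, hu⟩

end ModelCount

/-! ### The orbit sum over a prime field -/

section UnitSums

open Polynomial

variable {p : ℕ} [Fact p.Prime]

theorem sum_units_eq {M : Type*} [AddCommGroup M] {F : Type*} [Field F] [Fintype F] [Fintype Fˣ]
    (f : F → M) : ∑ u : Fˣ, f u = ∑ x, f x - f 0 := by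
  classical
  rw [← Finset.add_sum_erase Finset.univ f (Finset.mem_univ 0), add_sub_cancel_left]
  refine Finset.sum_bij (fun u _ => (u : F)) ?_ ?_ ?_ ?_
  · intro u _; simp
  · intro u _ u' _ h; exact Units.ext h
  · intro x hx; exact ⟨Units.mk0 x (Finset.ne_of_mem_erase hx), Finset.mem_univ _, rfl⟩
  · intro u _; rfl

/-- The polynomial has degree `4` or `6`, prime to `p ≥ 5`. Weil's bound contributes at most `5√p`,
and the missing term at `0` at most `1 ≤ √p`. -/
theorem norm_sum_units_stdAddChar_le (hp5 : 5 ≤ p) {c d : ZMod p} (hcd : c ≠ 0 ∨ d ≠ 0) :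
    ‖∑ u : (ZMod p)ˣ, ZMod.stdAddChar (c * (u : ZMod p) ^ 4 + d * (u : ZMod p) ^ 6)‖
      ≤ 6 * √p := by
  have hp := (Fact.out : p.Prime)
  have hψ : (ZMod.stdAddChar : AddChar (ZMod p) ℂ) ≠ 1 := by
    have := ZMod.isPrimitive_stdAddChar p (one_ne_zero)
    simpa using this
  set f : (ZMod p)[X] := C c * X ^ 4 + C d * X ^ 6 with hf
  have heval : ∀ x, f.eval x = c * x ^ 4 + d * x ^ 6 := fun x => by simp [hf]
  have h0 : f.coeff 0 = 0 := by simp [hf]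
  have hdeg : (f.natDegree = 4 ∨ f.natDegree = 6) := by
    by_cases hd : d = 0
    · left
      have hc : c ≠ 0 := hcd.resolve_right (not_not.mpr hd)
      rw [hf, hd, C_0, zero_mul, add_zero, natDegree_C_mul_X_pow 4 c hc]
    · right
      rw [hf, natDegree_add_eq_right_of_natDegree_lt, natDegree_C_mul_X_pow 6 d hd]
      rw [natDegree_C_mul_X_pow 6 d hd]
      exact (natDegree_C_mul_X_pow_le c 4).trans_lt (by norm_num)
  have hcop2 : p.Coprime 2 := (Nat.coprime_primes hp Nat.prime_two).mpr (by omega)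
  have hcop3 : p.Coprime 3 := (Nat.coprime_primes hp Nat.prime_three).mpr (by omega)
  have hcop : p.Coprime f.natDegree := by
    rcases hdeg with h | h <;> rw [h]
    · exact hcop2.mul_right hcop2
    · exact hcop2.mul_right hcop3
  have hw := norm_sum_addChar_eval_le hψ h0 (by omega) hcop
  have hsq : 1 ≤ √(p : ℝ) := by
    rw [Real.one_le_sqrt]; exact_mod_cast hp.one_le
  have h5 : ((f.natDegree - 1 : ℕ) : ℝ) ≤ 5 := by
    have : f.natDegree - 1 ≤ 5 := by omega
    exact_mod_cast this
  have hsum := sum_units_eq fun x : ZMod p => (ZMod.stdAddChar (c * x ^ 4 + d * x ^ 6) : ℂ)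
  rw [hsum]
  simp only [← heval]
  calc _ ≤ ‖∑ x : ZMod p, ZMod.stdAddChar (f.eval x)‖ + ‖ZMod.stdAddChar (f.eval 0)‖ :=
        norm_sub_le _ _
    _ ≤ 5 * √p + 1 := by
        rw [AddChar.norm_apply]
        gcongr
        exact hw.trans (by gcongr)
    _ ≤ _ := by linarith

end UnitSums

/-! ### The error term for lattice points -/

section BoxCount

variable {K : Type*} [Field K] [NumberField K]

theorem one_le_log_natCast {p : ℕ} (hp3 : 3 ≤ p) : 1 ≤ Real.log p := by
  have h3 : (3 : ℝ) ≤ p := by exact_mod_cast hp3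
  rw [Real.le_log_iff_exp_le (by linarith)]
  linarith [Real.exp_one_lt_d9]

/-- The number of coincidences between the orbit of `(a, b)` and a pair of boxes. -/
noncomputable def orbitBoxCount {n p : ℕ} [Fact p.Prime] (g : Fin n → ZMod p) (a b : ZMod p)
    (a₁ b₁ a₂ b₂ : Fin n → ℤ) : ℝ :=
  ∑ u : (ZMod p)ˣ,
    (((latticeBox a₁ b₁).filter fun x => ∑ j, (x j : ZMod p) * g j = (u : ZMod p) ^ 4 * a).card : ℝ)
    * (((latticeBox a₂ b₂).filter fun y =>
        ∑ j, (y j : ZMod p) * g j = (u : ZMod p) ^ 6 * b).card : ℝ)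

theorem abs_orbitBoxCount_sub_le {n p : ℕ} [Fact p.Prime] {g : Fin n → ZMod p} {a b : ZMod p}
    {a₁ b₁ a₂ b₂ : Fin n → ℤ} {τ D : ℝ} (hτ : 0 ≤ τ)
    (hT : ∀ h k : ZMod p, h ≠ 0 ∨ k ≠ 0 → ‖∑ u : (ZMod p)ˣ,
      ZMod.stdAddChar (-(h * ((u : ZMod p) ^ 4 * a) + k * ((u : ZMod p) ^ 6 * b)))‖ ≤ τ)
    (hD : ∀ c d : Fin n → ℤ, ∑ h : ZMod p with h ≠ 0,
        ‖∑ x ∈ latticeBox c d, ZMod.stdAddChar (h * ∑ j, (x j : ZMod p) * g j)‖ ≤ D) :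
    |(p : ℝ) ^ 2 * orbitBoxCount g a b a₁ b₁ a₂ b₂
        - (latticeBox a₁ b₁).card * (latticeBox a₂ b₂).card * (p - 1)|
      ≤ τ * D * ((latticeBox a₁ b₁).card + (latticeBox a₂ b₂).card) + τ * D * D := by
  have hp := (Fact.out : p.Prime)
  have h := abs_sq_mul_sum_card_sub_le (Finset.univ : Finset (ZMod p)ˣ) (latticeBox a₁ b₁)
    (latticeBox a₂ b₂) (fun u => (u : ZMod p) ^ 4 * a) (fun u => (u : ZMod p) ^ 6 * b)
    (fun x => ∑ j, (x j : ZMod p) * g j) (fun x => ∑ j, (x j : ZMod p) * g j) hτ hT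
    (hD a₁ b₁) (hD a₂ b₂)
  rw [Finset.card_univ, ZMod.card_units_eq_totient, Nat.totient_prime hp,
    Nat.cast_sub hp.one_le, Nat.cast_one] at h
  refine h.trans (le_of_eq ?_)
  ring

theorem exists_abs_orbitBoxCount_sub_le {n : ℕ} (hn : n ≠ 0)
    (γ : Module.Basis (Fin n) ℤ (𝓞 K)) :
    ∃ κ : ℝ, 0 ≤ κ ∧ ∀ (p : ℕ) [Fact p.Prime] (ρ : 𝓞 K →+* ZMod p), 5 ≤ p →
      (∀ j, ρ (γ j) ≠ 0) → ∀ a b : ZMod p, (n = 1 → a * b ≠ 0) →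
      ∀ a₁ b₁ a₂ b₂ : Fin n → ℤ,
      |(p : ℝ) ^ 2 * orbitBoxCount (fun j => ρ (γ j)) a b a₁ b₁ a₂ b₂
          - (latticeBox a₁ b₁).card * (latticeBox a₂ b₂).card * (p - 1)|
        ≤ κ * (((latticeBox a₁ b₁).card + (latticeBox a₂ b₂).card)
            * ((p : ℝ) ^ n * √p * Real.log p ^ n)
          + (p : ℝ) ^ (2 * n) * √p * Real.log p ^ (2 * n)) := by
  -- For `n = 1` the factor `√p` is saved in the orbit sum, by Weil; for `n ≥ 2` the orbit sum is
  -- bounded trivially by `p` and the saving is in the box sums.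
  rcases Nat.lt_or_ge n 2 with hn2 | hn2
  · obtain rfl : n = 1 := by omega
    refine ⟨24, by norm_num, fun p _ ρ hp5 hρ a b hab a₁ b₁ a₂ b₂ => ?_⟩
    have hab' := hab rfl
    have ha := left_ne_zero_of_mul hab'
    have hb := right_ne_zero_of_mul hab'
    have hlog := one_le_log_natCast (show 3 ≤ p by omega)
    have h := abs_orbitBoxCount_sub_le (g := fun j => ρ (γ j)) (a := a) (b := b) (a₁ := a₁)
      (b₁ := b₁) (a₂ := a₂) (b₂ := b₂) (τ := 6 * √p) (D := (2 * p * Real.log p) ^ 1)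
      (by positivity) (fun h k hhk => by
        have := norm_sum_units_stdAddChar_le (p := p) hp5 (c := -(h * a)) (d := -(k * b))
          (by simpa [ha, hb] using hhk)
        refine le_trans (le_of_eq ?_) this
        congr 1
        refine Finset.sum_congr rfl fun u _ => ?_
        congr 1; ring)
      (fun c d => sum_norm_latticeBox_le (by omega) hρ c d)
    refine h.trans ?_
    have hX : (0 : ℝ) ≤ (latticeBox a₁ b₁).card + (latticeBox a₂ b₂).card := by positivity
    have hq : (0 : ℝ) ≤ p * √p * Real.log p := by positivity
    have := mul_nonneg hX hq
    calc _ = 12 * (((latticeBox a₁ b₁).card + (latticeBox a₂ b₂).card) * (p * √p * Real.log p))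
          + 24 * ((p : ℝ) ^ (2 * 1) * √p * Real.log p ^ (2 * 1)) := by ring
      _ ≤ _ := by rw [pow_one, pow_one]; linarith
  · obtain ⟨κ, hκ, hfreq⟩ := exists_freqBound_le hn2 γ
    set κ' : ℝ := n * κ * 2 ^ (n - 1) with hκ'
    have hκ'0 : 0 ≤ κ' := by positivity
    refine ⟨κ' + κ' ^ 2, by positivity, fun p _ ρ hp5 hρ a b _ a₁ b₁ a₂ b₂ => ?_⟩
    have hp : (0 : ℝ) < p := by exact_mod_cast (Fact.out : p.Prime).pos
    have hp1 : (1 : ℝ) ≤ p := by exact_mod_cast (Fact.out : p.Prime).one_le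
    have hlog := one_le_log_natCast (show 3 ≤ p by omega)
    have hsq : 1 ≤ √(p : ℝ) := by rwa [Real.one_le_sqrt]
    set D : ℝ := n * (κ * √p * (2 * p * Real.log p) ^ (n - 1)) with hD
    have h := abs_orbitBoxCount_sub_le (g := fun j => ρ (γ j)) (a := a) (b := b) (a₁ := a₁)
      (b₁ := b₁) (a₂ := a₂) (b₂ := b₂) (τ := p) (D := D)
      hp.le (fun h k _ => by
        refine (norm_sum_le _ _).trans ?_
        simp only [AddChar.norm_apply, Finset.sum_const, Finset.card_univ, nsmul_eq_mul, mul_one]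
        rw [ZMod.card_units_eq_totient]
        exact_mod_cast Nat.totient_le p)
      (fun c d => sum_norm_latticeBox_le_of_freqBound_le (by omega) hn2 hρ (hfreq p ρ hρ) c d)
    refine h.trans ?_
    obtain ⟨m, rfl⟩ : ∃ m, n = m + 1 := ⟨n - 1, by omega⟩
    have hDeq : D = κ' * √p * p ^ m * Real.log p ^ m := by
      rw [hD, hκ', Nat.add_sub_cancel, mul_pow, mul_pow]; ring
    have hτD : p * D ≤ κ' * ((p : ℝ) ^ (m + 1) * √p * Real.log p ^ (m + 1)) := by
      rw [hDeq]
      calc _ = κ' * ((p : ℝ) ^ (m + 1) * √p * Real.log p ^ m) := by ring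
        _ ≤ _ := by gcongr; exact Nat.le_succ m
    -- Here the saving occurs twice, so there is room to spare: `1` is replaced by `√p` and the
    -- power of `log p` is raised to match the case `n = 1`.
    have hτDD : p * D * D ≤ κ' ^ 2 *
        ((p : ℝ) ^ (2 * (m + 1)) * √p * Real.log p ^ (2 * (m + 1))) := by
      rw [hDeq]
      calc _ = κ' ^ 2 * ((p : ℝ) ^ (2 * m + 1) * (√p * √p) * Real.log p ^ (2 * m)) := by ring
        _ = κ' ^ 2 * ((p : ℝ) ^ (2 * (m + 1)) * 1 * Real.log p ^ (2 * m)) := by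
            rw [Real.mul_self_sqrt hp.le]; ring
        _ ≤ _ := by gcongr; exact Nat.le_succ m
    set X : ℝ := (latticeBox a₁ b₁).card + (latticeBox a₂ b₂).card with hX
    have hX0 : 0 ≤ X := by positivity
    set Q₁ : ℝ := (p : ℝ) ^ (m + 1) * √p * Real.log p ^ (m + 1) with hQ₁
    set Q₂ : ℝ := (p : ℝ) ^ (2 * (m + 1)) * √p * Real.log p ^ (2 * (m + 1)) with hQ₂
    have hQ₁0 : 0 ≤ Q₁ := by positivity
    have hQ₂0 : 0 ≤ Q₂ := by positivity
    calc p * D * X + p * D * D ≤ κ' * Q₁ * X + κ' ^ 2 * Q₂ := by gcongr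
      _ ≤ _ := by
        have e1 : 0 ≤ κ' ^ 2 * (X * Q₁) := by positivity
        have e2 : 0 ≤ κ' * Q₂ := by positivity
        nlinarith

end BoxCount

/-! ### Lattice points against volumes -/

section Volumes

/-- Expanding gives `2 ^ s.card - 1` further terms, each missing at least one factor of size at
least `m` and possibly others of size at least `1`. -/
theorem prod_add_one_sub_prod_le {ι : Type*} (s : Finset ι) (y : ι → ℝ) {m : ℝ} (hm : 1 ≤ m)
    (hy : ∀ i ∈ s, m ≤ y i) :
    ∏ i ∈ s, (y i + 1) - ∏ i ∈ s, y i ≤ (2 ^ s.card - 1) * ((∏ i ∈ s, y i) / m) := by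
  classical
  induction s using Finset.induction_on with
  | empty => simp
  | insert i s his ih =>
    have hm0 : 0 < m := by linarith
    have ih' := ih fun j hj => hy j (Finset.mem_insert_of_mem hj)
    have hyi := hy i (Finset.mem_insert_self i s)
    have hQ : 0 ≤ ∏ j ∈ s, y j := Finset.prod_nonneg fun j hj =>
      by linarith [hy j (Finset.mem_insert_of_mem hj)]
    rw [Finset.prod_insert his, Finset.prod_insert his, Finset.card_insert_of_notMem his]
    set R := ∏ j ∈ s, (y j + 1)
    set Q := ∏ j ∈ s, y j
    set c : ℝ := 2 ^ s.card
    have hc : 1 ≤ c := one_le_pow₀ (by norm_num)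
    have hq : 0 ≤ Q / m := by positivity
    have hQm : Q = m * (Q / m) := by field_simp
    have h1 : (y i + 1) * (R - Q) ≤ (y i + 1) * ((c - 1) * (Q / m)) :=
      mul_le_mul_of_nonneg_left ih' (by linarith)
    have h2 : Q ≤ y i * (Q / m) := by
      conv_lhs => rw [hQm]
      exact mul_le_mul_of_nonneg_right hyi hq
    have h3 : 0 ≤ (c - 1) * (Q / m) * (y i - 1) :=
      mul_nonneg (mul_nonneg (by linarith) hq) (by linarith)
    have h4 : y i * Q / m = y i * (Q / m) := by ring
    rw [h4, pow_succ]
    change _ ≤ (c * 2 - 1) * _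
    nlinarith

theorem prod_add_one_le {ι : Type*} (s : Finset ι) (y : ι → ℝ) (hy : ∀ i ∈ s, 1 ≤ y i) :
    ∏ i ∈ s, (y i + 1) ≤ 2 ^ s.card * ∏ i ∈ s, y i := by
  rw [← Finset.prod_const, ← Finset.prod_mul_distrib]
  exact Finset.prod_le_prod (fun i hi => by linarith [hy i hi]) fun i hi => by linarith [hy i hi]

open CurveBox

variable {n : ℕ} {b₁ b₂ : Fin n → ℤ}

theorem vol_eq_prod (b : Fin n → ℤ) : vol b = ∏ j, (2 * (b j : ℝ)) := by
  simp [vol, Finset.prod_mul_distrib]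

theorem volTotal_eq_mul (b₁ b₂ : Fin n → ℤ) : volTotal b₁ b₂ = vol b₁ * vol b₂ := by
  rw [volTotal, vol, vol, Finset.prod_mul_distrib]; ring

theorem vol_nonneg {b : Fin n → ℤ} (hb : ∀ j, 0 < b j) : 0 ≤ vol b := by
  rw [vol_eq_prod]
  exact Finset.prod_nonneg fun j _ => by have : (0 : ℝ) < b j := by exact_mod_cast hb j
                                         linarith

theorem one_le_volMin (hn : n ≠ 0) (hb₁ : ∀ j, 0 < b₁ j) (hb₂ : ∀ j, 0 < b₂ j) :
    1 ≤ volMin b₁ b₂ := by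
  have : Nonempty (Fin n) := ⟨⟨0, Nat.pos_of_ne_zero hn⟩⟩
  have : (1 : ℝ) ≤ ⨅ j, min (b₁ j : ℝ) (b₂ j : ℝ) := le_ciInf fun j =>
    le_min (by exact_mod_cast hb₁ j) (by exact_mod_cast hb₂ j)
  rw [volMin]; linarith

theorem volMin_le (j : Fin n) : volMin b₁ b₂ ≤ 2 * b₁ j ∧ volMin b₁ b₂ ≤ 2 * b₂ j := by
  have h : ⨅ j, min (b₁ j : ℝ) (b₂ j : ℝ) ≤ min (b₁ j : ℝ) (b₂ j : ℝ) :=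
    ciInf_le (Set.finite_range _).bddBelow j
  have h' := le_min_iff.1 h
  rw [volMin]
  constructor <;> linarith [h'.1, h'.2]

theorem card_latticeBox_le (a : Fin n → ℤ) {b : Fin n → ℤ} (hb : ∀ j, 0 < b j) :
    ((latticeBox a b).card : ℝ) ≤ 2 ^ n * vol b := by
  rw [card_latticeBox hb, vol_eq_prod]
  have := prod_add_one_le Finset.univ (fun j => 2 * (b j : ℝ)) fun j _ => by
    have : (1 : ℝ) ≤ b j := by exact_mod_cast hb j
    linarith
  simpa using this

theorem vol_le_card_latticeBox (a : Fin n → ℤ) {b : Fin n → ℤ} (hb : ∀ j, 0 < b j) :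
    vol b ≤ (latticeBox a b).card := by
  rw [card_latticeBox hb, vol_eq_prod]
  refine Finset.prod_le_prod (fun j _ => ?_) fun j _ => by linarith
  have : (0 : ℝ) < b j := by exact_mod_cast hb j
  linarith

theorem card_mul_card_sub_volTotal_le (hn : n ≠ 0) (a₁ a₂ : Fin n → ℤ) (hb₁ : ∀ j, 0 < b₁ j)
    (hb₂ : ∀ j, 0 < b₂ j) :
    (latticeBox a₁ b₁).card * (latticeBox a₂ b₂).card - volTotal b₁ b₂
      ≤ 2 ^ (2 * n) * (volTotal b₁ b₂ / volMin b₁ b₂) := by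
  have hm := one_le_volMin hn hb₁ hb₂
  have h := prod_add_one_sub_prod_le (Finset.univ : Finset (Fin n ⊕ Fin n))
    (Sum.elim (fun j => 2 * (b₁ j : ℝ)) fun j => 2 * (b₂ j : ℝ)) hm
    (by rintro (j | j) - <;> [exact (volMin_le j).1; exact (volMin_le j).2])
  simp only [Fintype.prod_sum_type, Sum.elim_inl, Sum.elim_inr, Finset.card_univ,
    Fintype.card_sum, Fintype.card_fin, ← vol_eq_prod, ← card_latticeBox hb₁ (a := a₁),
    ← card_latticeBox hb₂ (a := a₂), ← volTotal_eq_mul, ← two_mul] at h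
  have hv : 0 ≤ volTotal b₁ b₂ / volMin b₁ b₂ := by
    rw [volTotal_eq_mul]
    have := vol_nonneg hb₁
    have := vol_nonneg hb₂
    positivity
  linarith

end Volumes

/-! ### Residue fields of degree-one primes -/

section DegreeOnePrimes

variable {K : Type*} [Field K]

theorem natCast_mem_of_liesOver (p : ℕ) (P : Ideal (𝓞 K))
    [P.LiesOver (Ideal.span {(p : ℤ)})] : (p : 𝓞 K) ∈ P := by
  have : (p : ℤ) ∈ P.under ℤ := by
    rw [← Ideal.over_def P (Ideal.span {(p : ℤ)})]
    exact Ideal.mem_span_singleton_self _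
  simpa [Ideal.under_def] using this

theorem isMaximal_of_liesOver_span_natCast (p : ℕ) [Fact p.Prime] (P : Ideal (𝓞 K)) [P.IsPrime]
    [P.LiesOver (Ideal.span {(p : ℤ)})] : P.IsMaximal :=
  have := Int.ideal_span_isMaximal_of_prime p
  .of_liesOver_isMaximal P (Ideal.span {(p : ℤ)})

variable [NumberField K]

theorem natCard_quotient_eq_of_inertiaDeg_eq_one (p : ℕ) [Fact p.Prime] (P : Ideal (𝓞 K))
    [P.IsPrime] [P.LiesOver (Ideal.span {(p : ℤ)})] (hf : P.inertiaDeg ℤ = 1) :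
    Nat.card (𝓞 K ⧸ P) = p := by
  have := isMaximal_of_liesOver_span_natCast p P
  have h := Ideal.pow_inertiaDeg p P
  rw [hf, pow_one] at h
  rw [h, Ideal.absNorm_apply, Submodule.cardQuot_apply]

end DegreeOnePrimes

/-! ### Assembling the estimate -/

section BoxCounting

open CurveBox

theorem autCount_pos {k : Type*} [Field k] [Finite k] (h2 : (2 : k) ≠ 0) (h3 : (3 : k) ≠ 0)
    (a b : k) : 0 < autCount (shortModel a b) := by
  rw [autCount_shortModel h2 h3]
  have : Nonempty {u : kˣ // a = (u : k) ^ 4 * a ∧ b = (u : k) ^ 6 * b} := ⟨⟨1, by simp⟩⟩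
  exact Nat.card_pos

theorem rpow_natCast_sub_three_halves {p : ℝ} (hp : 0 < p) (n : ℕ) :
    p ^ ((n : ℝ) - 3 / 2) = p ^ n * √p / p ^ 2 := by
  rw [show (n : ℝ) - 3 / 2 = n + 1 / 2 - (2 : ℕ) by push_cast; ring, Real.rpow_sub hp,
    Real.rpow_add hp, Real.rpow_natCast, Real.rpow_natCast, ← Real.sqrt_eq_rpow]

/-- Passage from the number of box points on an orbit to the number of points up to the
stabilizer, with the box cardinalities `X`, `Y` replaced by the volumes `v`, `w`. -/
theorem abs_count_sub_le {A c p X Y v w m d M κ Q R : ℝ} (hA : 1 ≤ A) (hp : 1 ≤ p)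
    (hκ : 0 ≤ κ) (hQ : 0 ≤ Q) (hm : 0 < m) (hv : 0 ≤ v) (hw : 0 ≤ w)
    (hvX : v ≤ X) (hwY : w ≤ Y) (hX : X ≤ d * v) (hY : Y ≤ d * w)
    (hXY : X * Y - v * w ≤ M * (v * w / m))
    (h : |p ^ 2 * (A * c) - X * Y * (p - 1)| ≤ κ * ((X + Y) * Q + R)) :
    |c - (p - 1) / (p ^ 2 * A) * (v * w)|
      ≤ M * (v * w / (p * m)) + κ * d * ((v + w) * (Q / p ^ 2)) + κ * (R / p ^ 2) := by
  have hp0 : 0 < p := by linarith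
  have hA0 : 0 < A := by linarith
  have hle : v * w ≤ X * Y := mul_le_mul hvX hwY hw (hv.trans hvX)
  -- Two errors: the Fourier remainder, with `X + Y` replaced by volumes, and `(p - 1)(XY - vw)`
  -- from replacing lattice points by volume.
  have h1 : |p ^ 2 * (A * c) - (p - 1) * (v * w)|
      ≤ κ * (d * (v + w) * Q + R) + p * (M * (v * w / m)) := by
    calc _ = |(p ^ 2 * (A * c) - X * Y * (p - 1)) + (p - 1) * (X * Y - v * w)| := by
          congr 1; ring
      _ ≤ _ := abs_add_le _ _
      _ ≤ κ * ((X + Y) * Q + R) + p * (X * Y - v * w) := by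
          refine add_le_add h ?_
          rw [abs_of_nonneg (mul_nonneg (by linarith) (by linarith))]
          exact mul_le_mul_of_nonneg_right (by linarith) (by linarith)
      _ ≤ _ := by
          gcongr
          linarith
  calc |c - (p - 1) / (p ^ 2 * A) * (v * w)|
      = |p ^ 2 * (A * c) - (p - 1) * (v * w)| / (p ^ 2 * A) := by
        rw [← abs_of_pos (show 0 < p ^ 2 * A by positivity), ← abs_div,
          abs_of_pos (show 0 < p ^ 2 * A by positivity)]
        congr 1
        field_simp
    _ ≤ |p ^ 2 * (A * c) - (p - 1) * (v * w)| / p ^ 2 := by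
        gcongr
        exact le_mul_of_one_le_right (by positivity) hA
    _ ≤ (κ * (d * (v + w) * Q + R) + p * (M * (v * w / m))) / p ^ 2 := by gcongr
    _ = _ := by field_simp; ring

theorem mul_add_mul_add_mul_le {r s t x y z : ℝ} (hr : 0 ≤ r) (hs : 0 ≤ s) (ht : 0 ≤ t)
    (hx : 0 ≤ x) (hy : 0 ≤ y) (hz : 0 ≤ z) :
    r * x + s * y + t * z ≤ (r + s + t) * (x + y + z) := by
  have : 0 ≤ r * (y + z) + s * (x + z) + t * (x + y) := by positivity
  linarith

end BoxCounting

theorem mainTheorem8 (K : Type*) [Field K] [NumberField K] [IsGalois ℚ K]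
    (γ : Module.Basis (Fin (Module.finrank ℚ K)) ℤ (𝓞 K)) :
    ∃ C : ℝ, ∀ (p : ℕ) (_ : p.Prime) (P : Ideal (𝓞 K)) (_ : P.IsPrime)
      (_ : P.LiesOver (Ideal.span {(p : ℤ)}))
      (_ : P.inertiaDeg ℤ = 1)
      (_ : 6 * ∏ j, γ j ∉ P)
      (a b : 𝓞 K ⧸ P) (_ : (CurveBox.shortModel a b).IsElliptic),
      -- the number of automorphisms of `E_{a,b}` over `𝓞 K ⧸ P`
      ((a * b ≠ 0 → CurveBox.autCount (CurveBox.shortModel a b) = 2) ∧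
        (a ≠ 0 → b = 0 →
          CurveBox.autCount (CurveBox.shortModel a b) = Nat.gcd 4 (p - 1)) ∧
        (a = 0 → b ≠ 0 →
          CurveBox.autCount (CurveBox.shortModel a b) = Nat.gcd 6 (p - 1))) ∧
      -- the count of models; for `K = ℚ` the curves with `ab = 0` are excluded
      ((Module.finrank ℚ K = 1 → a * b ≠ 0) →
        ∀ a₁ b₁ a₂ b₂ : Fin (Module.finrank ℚ K) → ℤ,
          (∀ j, 0 < b₁ j) → (∀ j, 0 < b₂ j) →
          |((CurveBox.modelsReducingTo γ a₁ b₁ a₂ b₂ P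
                (CurveBox.shortModel a b)).ncard : ℝ)
              - ((p : ℝ) - 1) /
                  ((p : ℝ) ^ 2 * (CurveBox.autCount (CurveBox.shortModel a b) : ℝ))
                * CurveBox.volTotal b₁ b₂|
            ≤ C * (CurveBox.volTotal b₁ b₂ / ((p : ℝ) * CurveBox.volMin b₁ b₂)
                + (CurveBox.vol b₁ + CurveBox.vol b₂)
                    * (p : ℝ) ^ ((Module.finrank ℚ K : ℝ) - 3 / 2)
                    * Real.log p ^ Module.finrank ℚ K
                + (p : ℝ) ^ (2 * (Module.finrank ℚ K : ℝ) - 3 / 2)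
                    * Real.log p ^ (2 * Module.finrank ℚ K))) := by
  have hn : Module.finrank ℚ K ≠ 0 := Module.finrank_pos.ne'
  obtain ⟨κ, hκ, hcount⟩ := exists_abs_orbitBoxCount_sub_le hn γ
  refine ⟨2 ^ (2 * Module.finrank ℚ K) + κ * 2 ^ Module.finrank ℚ K + κ, ?_⟩
  intro p hp P hP hover hf hγ a b _
  have := Fact.mk hp
  have hmax := isMaximal_of_liesOver_span_natCast p P
  have hcard := natCard_quotient_eq_of_inertiaDeg_eq_one p P hf
  have : Finite (𝓞 K ⧸ P) := Nat.finite_of_card_ne_zero (hcard ▸ hp.ne_zero)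
  have h6 : (6 : 𝓞 K) ∉ P := fun h => hγ (P.mul_mem_right _ h)
  have hγP : ∀ j, γ j ∉ P := fun j h =>
    hγ (P.mul_mem_left _ (P.mem_of_dvd (Finset.dvd_prod_of_mem _ (Finset.mem_univ j)) h))
  have h2P : (2 : 𝓞 K) ∉ P := fun h => h6 (by
    have := P.mul_mem_left 3 h; norm_num at this; exact this)
  have h3P : (3 : 𝓞 K) ∉ P := fun h => h6 (by
    have := P.mul_mem_left 2 h; norm_num at this; exact this)
  have h2 : (2 : 𝓞 K ⧸ P) ≠ 0 := fun h => h2P (Ideal.Quotient.eq_zero_iff_mem.1 h)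
  have h3 : (3 : 𝓞 K ⧸ P) ≠ 0 := fun h => h3P (Ideal.Quotient.eq_zero_iff_mem.1 h)
  -- Since `p ∈ P` while `2, 3 ∉ P`, the primes `2` and `3` are excluded.
  have hp5 : 5 ≤ p := by
    have hpP := natCast_mem_of_liesOver p P
    by_contra! hlt
    have := hp.two_le
    interval_cases p
    · exact h2P (by exact_mod_cast hpP)
    · exact h3P (by exact_mod_cast hpP)
    · exact absurd hp (by norm_num)
  let := Ideal.Quotient.field P
  refine ⟨⟨autCount_eq_two h2 h3,
    fun ha hb => hcard ▸ autCount_eq_gcd_four h2 h3 ha hb,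
    fun ha hb => hcard ▸ autCount_eq_gcd_six h2 h3 ha hb⟩, fun hab a₁ b₁ a₂ b₂ hb₁ hb₂ => ?_⟩
  have := Fintype.ofFinite (𝓞 K ⧸ P)
  have e : 𝓞 K ⧸ P ≃+* ZMod p :=
    (ZMod.ringEquivOfPrime (𝓞 K ⧸ P) hp (by rw [← Nat.card_eq_fintype_card, hcard])).symm
  have herr := hcount p (e.toRingHom.comp (Ideal.Quotient.mk P)) hp5
    (fun j => by simpa [Ideal.Quotient.eq_zero_iff_mem] using hγP j) (e a) (e b)
    (fun h1 => by simpa [← map_mul] using hab h1) a₁ b₁ a₂ b₂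
  have hN := autCount_mul_ncard_eq γ a₁ b₁ a₂ b₂ P h2 h3 e a b
  have hN' : orbitBoxCount (fun j => (e.toRingHom.comp (Ideal.Quotient.mk P)) (γ j)) (e a) (e b)
      a₁ b₁ a₂ b₂ = (CurveBox.autCount (CurveBox.shortModel a b) : ℝ)
        * ((CurveBox.modelsReducingTo γ a₁ b₁ a₂ b₂ P (CurveBox.shortModel a b)).ncard : ℝ) := by
    rw [← Nat.cast_mul, hN, orbitBoxCount]
    push_cast
    rfl
  rw [hN'] at herr
  have hp0 : (0 : ℝ) < p := by exact_mod_cast hp.pos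
  have hlog := one_le_log_natCast (show 3 ≤ p by omega)
  have hv := vol_nonneg hb₁
  have hw := vol_nonneg hb₂
  have hm : 0 < CurveBox.volMin b₁ b₂ := zero_lt_one.trans_le (one_le_volMin hn hb₁ hb₂)
  have hXY := card_mul_card_sub_volTotal_le hn a₁ a₂ hb₁ hb₂
  rw [volTotal_eq_mul] at hXY ⊢
  have hfinal := abs_count_sub_le (by exact_mod_cast autCount_pos h2 h3 a b)
    (by exact_mod_cast hp.one_le) hκ (by positivity) hm hv hw (vol_le_card_latticeBox a₁ hb₁)
    (vol_le_card_latticeBox a₂ hb₂) (card_latticeBox_le a₁ hb₁) (card_latticeBox_le a₂ hb₂) hXY herr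
  refine hfinal.trans ?_
  have hr := rpow_natCast_sub_three_halves hp0 (2 * Module.finrank ℚ K)
  push_cast at hr
  rw [rpow_natCast_sub_three_halves hp0, hr]
  refine le_trans (le_of_eq ?_) (mul_add_mul_add_mul_le (by positivity) (by positivity) hκ
    (by positivity) (by positivity) (by positivity))
  ring
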